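/- Let $\mathcal O_2$ be the ring of germs at the origin of holomorphic functions on $\mathbb C^2$. For $g,h\in\mathcal O_2$ let $m(g,h)=\dim_{\mathbb C}\mathcal O_2/\langle g,h\rangle\in\mathbb N\cup\{\infty\}$ be their intersection number. Two germs $g,h\in\mathcal O_2$ are $\mathcal K$-equivalent if $h=A\cdot(g\circ\phi^{-1})$ for some germ of a biholomorphic map $\phi:(\mathbb C^2,0)\to(\mathbb C^2,0)$ and some unit $A\in\mathcal O_2$; the $\mathcal K$-orbit of $g$ is the set of all germs $\mathcal K$-equivalent to it. For $g\in\mathcal O_2$ put $$i_g=g_y^2g_{xx}-2g_xg_yg_{xy}+g_x^2g_{yy},$$ $$v_g=(g_x^2+g_y^2)\left(g_x^3g_{yyy}-3g_x^2g_yg_{xyy}+3g_xg_y^2g_{xxy}-g_y^3g_{xxx}\right)-3\left((g_x^2-g_y^2)g_{xy}-g_xg_y(g_{xx}-g_{yy})\right)i_g,$$ and let $I_g=m(g,i_g)$ and $V_g=m(g,v_g)$ be the numbers of inflections and of vertices of the curve $g=0$ concentrated at the origin. Let $I_g^0$ (resp. $V_g^0$) denote the minimal value of $I_h$ (resp. $V_h$)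 as $h$ ranges over the $\mathcal K$-orbit of $g$. Theorem. Let $f=f_1\cdots f_k$, where each $f_j\in\mathcal O_2$ is irreducible and $f$ has no repeated factors. Then $$I_f^0=\sum_{j=1}^k I_{f_j}^0+6\sum_{1\le i<j\le k}m(f_i,f_j),\qquad V_f^0=\sum_{j=1}^k V_{f_j}^0+12\sum_{1\le i<j\le k}m(f_i,f_j).$$ -/

import Mathlib

open Filter Topology

namespace PlaneCurve

/-- Germs of functions on `ℂ²` at the origin form a `ℂ`-algebra under the pointwise operations. -/
noncomputable instance germAlgebra : Algebra ℂ (Germ (𝓝 (0 : ℂ × ℂ)) ℂ) :=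
  Algebra.ofModule
    (fun r x y => by
      induction x using Germ.inductionOn with | _ F
      induction y using Germ.inductionOn with | _ G
      exact congrArg Germ.ofFun (smul_mul_assoc r F G))
    (fun r x y => by
      induction x using Germ.inductionOn with | _ F
      induction y using Germ.inductionOn with | _ G
      exact congrArg Germ.ofFun (mul_smul_comm r F G))

/-- The ring `𝒪₂` of germs at the origin of holomorphic functions on `ℂ²`, as a subalgebra of the
algebra of all germs of functions at the origin. -/
def HolGerm : Subalgebra ℂ (Germ (𝓝 (0 : ℂ × ℂ)) ℂ) where
  carrier := {g | ∃ F : ℂ × ℂ → ℂ, AnalyticAt ℂ F 0 ∧ g = (F : Germ (𝓝 (0 : ℂ × ℂ)) ℂ)}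
  mul_mem' := by
    rintro _ _ ⟨F, hF, rfl⟩ ⟨G, hG, rfl⟩
    exact ⟨F * G, hF.mul hG, rfl⟩
  add_mem' := by
    rintro _ _ ⟨F, hF, rfl⟩ ⟨G, hG, rfl⟩
    exact ⟨F + G, hF.add hG, rfl⟩
  algebraMap_mem' c := ⟨fun _ => c • (1 : ℂ), analyticAt_const, rfl⟩

theorem exists_rep (f : HolGerm) :
    ∃ F : ℂ × ℂ → ℂ, AnalyticAt ℂ F 0 ∧ f.1 = (F : Germ (𝓝 (0 : ℂ × ℂ)) ℂ) :=
  f.2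

/-- The derivative in the direction `v` of a germ of a function on `ℂ²`. -/
noncomputable def germDeriv (v : ℂ × ℂ) (g : Germ (𝓝 (0 : ℂ × ℂ)) ℂ) :
    Germ (𝓝 (0 : ℂ × ℂ)) ℂ :=
  Germ.map' (lc := 𝓝 (0 : ℂ × ℂ)) (fun (F : ℂ × ℂ → ℂ) (p : ℂ × ℂ) => fderiv ℂ F p v)
    (fun _ _ h => (EventuallyEq.fderiv (𝕜 := ℂ) h).mono fun _ hp => congrArg (· v) hp) g

/-- The derivative of a holomorphic germ in the direction `v`. -/
noncomputable def dirDeriv (v : ℂ × ℂ) (f : HolGerm) : HolGerm :=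
  ⟨germDeriv v f.1, by
    obtain ⟨F, hF, hf⟩ := exists_rep f
    rw [hf]
    exact ⟨fun p => fderiv ℂ F p v,
      ((ContinuousLinearMap.apply ℂ ℂ v).analyticAt _).comp hF.fderiv, rfl⟩⟩

/-- The partial derivative `∂f/∂x`. -/
noncomputable def dx (f : HolGerm) : HolGerm := dirDeriv (1, 0) f

/-- The partial derivative `∂f/∂y`. -/
noncomputable def dy (f : HolGerm) : HolGerm := dirDeriv (0, 1) f

/-- A germ of a biholomorphic map `(ℂ², 0) → (ℂ², 0)`, given by a representative together with a
representative of the inverse germ. -/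
structure Biholo where
  toFun : ℂ × ℂ → ℂ × ℂ
  invFun : ℂ × ℂ → ℂ × ℂ
  analytic_toFun : AnalyticAt ℂ toFun 0
  analytic_invFun : AnalyticAt ℂ invFun 0
  map_zero : toFun 0 = 0
  inv_zero : invFun 0 = 0
  left_inv : ∀ᶠ p in 𝓝 (0 : ℂ × ℂ), invFun (toFun p) = p
  right_inv : ∀ᶠ p in 𝓝 (0 : ℂ × ℂ), toFun (invFun p) = p

theorem Biholo.tendsto_invFun (φ : Biholo) :
    Tendsto φ.invFun (𝓝 (0 : ℂ × ℂ)) (𝓝 (0 : ℂ × ℂ)) := by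
  simpa only [ContinuousAt, φ.inv_zero] using φ.analytic_invFun.continuousAt

/-- The germ `f ∘ φ⁻¹`. -/
noncomputable def compInv (f : HolGerm) (φ : Biholo) : HolGerm :=
  ⟨f.1.compTendsto φ.invFun φ.tendsto_invFun, by
    obtain ⟨F, hF, hf⟩ := exists_rep f
    rw [hf]
    exact ⟨F ∘ φ.invFun, AnalyticAt.comp (by rw [φ.inv_zero]; exact hF) φ.analytic_invFun, rfl⟩⟩

/-- `𝒦`-equivalence of holomorphic function germs: `g = A · (f ∘ φ⁻¹)` with `φ` the germ of a
biholomorphic map fixing the origin and `A` an invertible holomorphic germ. -/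
def KEquiv (f g : HolGerm) : Prop :=
  ∃ (φ : Biholo) (A : HolGermˣ), g = A * compInv f φ

theorem KEquiv.refl (f : HolGerm) : KEquiv f f :=
  ⟨⟨id, id, analyticAt_id, analyticAt_id, rfl, rfl, .of_forall fun _ => rfl,
    .of_forall fun _ => rfl⟩, 1, by
    obtain ⟨F, hF, hf⟩ := exists_rep f
    rw [Units.val_one, one_mul]
    apply Subtype.ext
    simp only [compInv, hf]
    rfl⟩

/-- The intersection number `m(f, g) = dim_ℂ 𝒪₂ / ⟨f, g⟩`, possibly infinite. -/
noncomputable def interNum (f g : HolGerm) : ℕ∞ :=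
  Cardinal.toENat (Module.rank ℂ (HolGerm ⧸ Ideal.span {f, g}))

/-- The germ `i_f` whose zeros on `f = 0` are the inflections. -/
noncomputable def inflGerm (f : HolGerm) : HolGerm :=
  dy f ^ 2 * dx (dx f) - 2 * dx f * dy f * dx (dy f) + dx f ^ 2 * dy (dy f)

/-- The germ `v_f` whose zeros on `f = 0` are the vertices. -/
noncomputable def vertGerm (f : HolGerm) : HolGerm :=
  (dx f ^ 2 + dy f ^ 2) *
      (dx f ^ 3 * dy (dy (dy f)) - 3 * dx f ^ 2 * dy f * dx (dy (dy f))
        + 3 * dx f * dy f ^ 2 * dx (dx (dy f)) - dy f ^ 3 * dx (dx (dx f)))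
    - 3 * ((dx f ^ 2 - dy f ^ 2) * dx (dy f) - dx f * dy f * (dx (dx f) - dy (dy f))) *
      (dy f ^ 2 * dx (dx f) - 2 * dx f * dy f * dx (dy f) + dx f ^ 2 * dy (dy f))

/-- The number `I_f` of inflections of `f = 0` concentrated at the origin. -/
noncomputable def inflNum (f : HolGerm) : ℕ∞ := interNum f (inflGerm f)

/-- The number `V_f` of vertices of `f = 0` concentrated at the origin. -/
noncomputable def vertNum (f : HolGerm) : ℕ∞ := interNum f (vertGerm f)

/-- The minimal value `I_f⁰` of `I_g` over all `g` in the `𝒦`-orbit of `f`. -/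
noncomputable def minInflNum (f : HolGerm) : ℕ∞ := sInf {n | ∃ g, KEquiv f g ∧ inflNum g = n}

/-- The minimal value `V_f⁰` of `V_g` over all `g` in the `𝒦`-orbit of `f`. -/
noncomputable def minVertNum (f : HolGerm) : ℕ∞ := sInf {n | ∃ g, KEquiv f g ∧ vertNum g = n}

theorem isLeast_minInflNum (f : HolGerm) :
    IsLeast {n | ∃ g, KEquiv f g ∧ inflNum g = n} (minInflNum f) :=
  ⟨csInf_mem ⟨_, f, KEquiv.refl f, rfl⟩, fun _ h => sInf_le h⟩

theorem isLeast_minVertNum (f : HolGerm) :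
    IsLeast {n | ∃ g, KEquiv f g ∧ vertNum g = n} (minVertNum f) :=
  ⟨csInf_mem ⟨_, f, KEquiv.refl f, rfl⟩, fun _ h => sInf_le h⟩

end PlaneCurve

/-! Let `D` be the Hamiltonian field of `f`, which is tangent to the level curves of `f`. Up to
sign, `i_f` is the wedge of velocity and acceleration along the flow of `D`, and `v_f` is the
numerator of the derivative of curvature. Moving the curve by a biholomorphism amounts to keeping
`f` and replacing `(x, y)` by another coordinate pair `(p, q)`, so each minimum is taken over
coordinate pairs.

Modulo `f`, replacing `f` by `a * f` multiplies `D` by `a`. The two expressions are therefore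
multiplied by `a ^ c`, with `c = 3` and `c = 6`. Restricting the expression of the product to the
branch `f j` gives that branch's own number plus `c` times its intersection numbers with the other
branches. Summing over the branches counts each pair twice, so in every coordinate system the excess
over the sum of the branch numbers is `2 * c` times the sum over pairs (`interNum_prod_eq`).

It remains to minimise all branches in one coordinate system (`exists_forall_minNum_eq`). On a line
of coordinate pairs joining two systems, the expressions are polynomial in the parameter, and
intersection numbers are upper semicontinuous (`eventually_interNum_le`). All but finitely many
members of the line are thus at least as good as either end, for every branch under consideration,
and induction on the branches finishes. All identities live in `ℕ∞`, so infinite values need no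
separate theorem. -/

namespace PlaneCurve

/-! ### Parametric integrals and division by a linear form -/

/-- Averaging an analytic function along a continuous family of linear maps gives an analytic
function. -/
theorem analyticAt_intervalIntegral_comp {E : Type*} [NormedAddCommGroup E] [NormedSpace ℂ E]
    {R : E → ℂ} (hR : AnalyticAt ℂ R 0) {A : ℝ → E →L[ℂ] E} (hA : Continuous A) :
    AnalyticAt ℂ (fun z => ∫ t in (0 : ℝ)..1, R (A t z)) 0 := by
  obtain ⟨p, r, hp⟩ := hR
  obtain ⟨K₀, hK₀⟩ := (isCompact_Icc (a := (0 : ℝ)) (b := 1)).exists_bound_of_continuousOn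
    hA.continuousOn
  obtain ⟨K, hK1, hK⟩ : ∃ K : ℝ, 1 ≤ K ∧ ∀ t ∈ Set.Icc (0 : ℝ) 1, ‖A t‖ ≤ K :=
    ⟨max 1 K₀, le_max_left _ _, fun t ht => (hK₀ t ht).trans (le_max_right _ _)⟩
  have hK0 : 0 < K := by linarith
  obtain ⟨ρ, hρ0, hρr⟩ := ENNReal.lt_iff_exists_nnreal_btwn.1 hp.r_pos
  have hρ : (0 : ℝ) < ρ := by exact_mod_cast hρ0
  have hρp : (ρ : ENNReal) < p.radius := hρr.trans_le hp.r_le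
  have hcont (n : ℕ) :
      Continuous fun t => (p n).compContinuousLinearMap (fun _ : Fin n => A t) :=
    (ContinuousMultilinearMap.compContinuousLinearMapLRight (E := fun _ => E) (p n)).cont.comp
      (continuous_pi fun _ => hA)
  -- The candidate series is the termwise average of the series of `R` composed with `A t`. Since
  -- `‖A t‖ ≤ K`, it converges on radius `ρ / K`.
  let q : FormalMultilinearSeries ℂ E ℂ := fun n =>
    ∫ t in (0 : ℝ)..1, (p n).compContinuousLinearMap (fun _ : Fin n => A t)
  have hbound (n : ℕ) (t : ℝ) (ht : t ∈ Set.Icc (0 : ℝ) 1) :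
      ‖(p n).compContinuousLinearMap (fun _ : Fin n => A t)‖ ≤ ‖p n‖ * K ^ n := by
    refine ((p n).norm_compContinuousLinearMap_le _).trans ?_
    rw [Finset.prod_const, Finset.card_univ, Fintype.card_fin]
    gcongr
    exact hK t ht
  have hq (n : ℕ) : ‖q n‖ ≤ ‖p n‖ * K ^ n := by
    have := intervalIntegral.norm_integral_le_of_norm_le_const (a := (0 : ℝ)) (b := 1)
      (f := fun t => (p n).compContinuousLinearMap (fun _ : Fin n => A t))
      (C := ‖p n‖ * K ^ n) fun t ht => hbound n t (by
        rw [Set.uIoc_of_le zero_le_one] at ht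
        exact ⟨ht.1.le, ht.2⟩)
    simpa using this
  have hqz (n : ℕ) (z : E) :
      q n (fun _ => z) = ∫ t in (0 : ℝ)..1, p n (fun _ => A t z) := by
    have := (ContinuousMultilinearMap.apply ℂ (fun _ : Fin n => E) ℂ
      (fun _ => z)).intervalIntegral_comp_comm ((hcont n).intervalIntegrable
        (μ := MeasureTheory.volume) 0 1)
    exact this.symm
  let σ : NNReal := ⟨ρ / K, by positivity⟩
  have hσ : (0 : ENNReal) < σ := by
    have : (0 : ℝ) < ρ / K := by positivity
    exact ENNReal.coe_pos.2 this
  obtain ⟨C, hC0, hC⟩ := p.norm_mul_pow_le_of_lt_radius hρp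
  refine ⟨q, σ, ?_, hσ, ?_⟩
  · refine q.le_radius_of_bound C fun n => ?_
    calc ‖q n‖ * (σ : ℝ) ^ n ≤ ‖p n‖ * K ^ n * (ρ / K) ^ n := by gcongr; exacts [hq n, le_rfl]
      _ = ‖p n‖ * ρ ^ n := by rw [mul_assoc, ← mul_pow, mul_div_cancel₀ _ hK0.ne']
      _ ≤ C := hC n
  · intro z hz
    have hzσ : ‖z‖ < ρ / K := by
      have : ‖z‖ < (σ : ℝ) := by simpa [enorm] using hz
      exact this
    have hAz (t : ℝ) (ht : t ∈ Set.Icc (0 : ℝ) 1) : ‖A t z‖ < ρ :=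
      calc ‖A t z‖ ≤ ‖A t‖ * ‖z‖ := (A t).le_opNorm z
        _ ≤ K * ‖z‖ := by gcongr; exact hK t ht
        _ < K * (ρ / K) := by gcongr
        _ = ρ := mul_div_cancel₀ _ hK0.ne'
    simp only [zero_add, hqz]
    refine intervalIntegral.hasSum_integral_of_dominated_convergence
      (fun n _ => ‖p n‖ * ρ ^ n) (fun n => ?_) (fun n => ?_) ?_ ?_ ?_
    · exact ((ContinuousMultilinearMap.apply ℂ (fun _ : Fin n => E) ℂ
        (fun _ => z)).continuous.comp (hcont n)).aestronglyMeasurable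
    · refine .of_forall fun t ht => ?_
      rw [Set.uIoc_of_le zero_le_one] at ht
      refine ((p n).le_opNorm _).trans ?_
      rw [Finset.prod_const, Finset.card_univ, Fintype.card_fin]
      gcongr
      exact (hAz t ⟨ht.1.le, ht.2⟩).le
    · exact .of_forall fun t _ => p.summable_norm_mul_pow hρp
    · exact intervalIntegrable_const
    · refine .of_forall fun t ht => ?_
      rw [Set.uIoc_of_le zero_le_one] at ht
      have hmem : A t z ∈ Metric.eball (0 : E) r := by
        have h1 : ‖A t z‖₊ < ρ := hAz t ⟨ht.1.le, ht.2⟩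
        have : ‖A t z‖ₑ < r := lt_trans (by simpa [enorm] using h1) hρr
        simpa using this
      simpa using hp.hasSum hmem

/-- Division of an analytic function by a linear form: if `z = u z + l z • e`, then
`F z - F (u z)` is divisible by `l`. -/
theorem exists_eq_comp_add_mul {E : Type*} [NormedAddCommGroup E] [NormedSpace ℂ E]
    {F : E → ℂ} (hF : AnalyticAt ℂ F 0) (u : E →L[ℂ] E) (l : E →L[ℂ] ℂ) (e : E)
    (hu : ∀ z, z = u z + l z • e) :
    ∃ G : E → ℂ, AnalyticAt ℂ G 0 ∧ ∀ᶠ z in 𝓝 0, F z = F (u z) + l z * G z := by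
  -- `A t z` runs along the segment from `u z` to `z`. The fundamental theorem of calculus on it
  -- yields the quotient `G` as the average of the derivative of `F` in direction `e`.
  let A : ℝ → E →L[ℂ] E := fun t => u + (t : ℂ) • l.smulRight e
  have hA : Continuous A :=
    continuous_const.add (Complex.continuous_ofReal.smul continuous_const)
  have hR : AnalyticAt ℂ (fun z => fderiv ℂ F z e) 0 :=
    ((ContinuousLinearMap.apply ℂ ℂ e).analyticAt _).comp hF.fderiv
  refine ⟨_, analyticAt_intervalIntegral_comp hR hA, ?_⟩
  obtain ⟨ε, hε, hFε⟩ := Metric.eventually_nhds_iff.1 hF.eventually_analyticAt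
  obtain ⟨K₀, hK₀⟩ := (isCompact_Icc (a := (0 : ℝ)) (b := 1)).exists_bound_of_continuousOn
    hA.continuousOn
  obtain ⟨K, hK1, hK⟩ : ∃ K : ℝ, 1 ≤ K ∧ ∀ t ∈ Set.Icc (0 : ℝ) 1, ‖A t‖ ≤ K :=
    ⟨max 1 K₀, le_max_left _ _, fun t ht => (hK₀ t ht).trans (le_max_right _ _)⟩
  have hK0 : 0 < K := by linarith
  filter_upwards [Metric.ball_mem_nhds (0 : E) (div_pos hε hK0)] with z hz
  have hz' : ‖z‖ < ε / K := by simpa using hz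
  have han (t : ℝ) (ht : t ∈ Set.uIcc (0 : ℝ) 1) : AnalyticAt ℂ F (A t z) := by
    rw [Set.uIcc_of_le zero_le_one] at ht
    refine hFε ?_
    rw [dist_zero_right]
    calc ‖A t z‖ ≤ ‖A t‖ * ‖z‖ := (A t).le_opNorm z
      _ ≤ K * ‖z‖ := by gcongr; exact hK t ht
      _ < K * (ε / K) := by gcongr
      _ = ε := mul_div_cancel₀ _ hK0.ne'
  have hAd (t : ℝ) : HasDerivAt (fun t => A t z) (l z • e) t := by
    have h1 : HasDerivAt (fun t : ℝ => (t : ℂ)) 1 t := Complex.ofRealCLM.hasDerivAt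
    have h2 := (h1.smul_const (l z • e)).const_add (u z)
    simpa [A] using h2
  have hAz : Continuous fun t => A t z :=
    (ContinuousLinearMap.apply ℂ E z).continuous.comp hA
  have hftc := intervalIntegral.integral_eq_sub_of_hasDerivAt
    (f := fun t => F (A t z)) (f' := fun t => l z * fderiv ℂ F (A t z) e) (a := 0) (b := 1)
    (fun t ht => by
      have h1 := ((han t ht).differentiableAt.hasFDerivAt.restrictScalars ℝ).comp_hasDerivAt t
        (hAd t)
      exact h1.congr_deriv (by simp))
    (ContinuousOn.intervalIntegrable fun t ht => by
      have h1 : ContinuousAt (fun z => fderiv ℂ F z e) (A t z) :=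
        (((ContinuousLinearMap.apply ℂ ℂ e).analyticAt _).comp (han t ht).fderiv).continuousAt
      exact (continuousAt_const.mul (ContinuousAt.comp (f := fun t => A t z) h1
        hAz.continuousAt)).continuousWithinAt)
  have hA1 : A 1 z = z := by simpa [A] using (hu z).symm
  have hA0 : A 0 z = u z := by simp [A]
  rw [intervalIntegral.integral_const_mul, hA1, hA0] at hftc
  rw [hftc]
  ring

end PlaneCurve

/-! ### The local ring of holomorphic germs -/

namespace PlaneCurve
namespace HolGerm

/-- The germ of a function that is analytic at the origin. -/
noncomputable def mk (F : ℂ × ℂ → ℂ) (hF : AnalyticAt ℂ F 0) : HolGerm := ⟨F, F, hF, rfl⟩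

theorem exists_mk (f : HolGerm) : ∃ F hF, f = mk F hF := by
  obtain ⟨F, hF, hf⟩ := exists_rep f
  exact ⟨F, hF, Subtype.ext hf⟩

theorem mk_eq_mk {F G : ℂ × ℂ → ℂ} {hF : AnalyticAt ℂ F 0} {hG : AnalyticAt ℂ G 0} :
    mk F hF = mk G hG ↔ F =ᶠ[𝓝 0] G :=
  Subtype.ext_iff.trans Germ.coe_eq

theorem mk_add {F G : ℂ × ℂ → ℂ} (hF : AnalyticAt ℂ F 0) (hG : AnalyticAt ℂ G 0) :
    mk F hF + mk G hG = mk (F + G) (hF.add hG) := rfl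

theorem mk_mul {F G : ℂ × ℂ → ℂ} (hF : AnalyticAt ℂ F 0) (hG : AnalyticAt ℂ G 0) :
    mk F hF * mk G hG = mk (F * G) (hF.mul hG) := rfl

theorem one_eq_mk : (1 : HolGerm) = mk (fun _ => 1) analyticAt_const := rfl

theorem zero_eq_mk : (0 : HolGerm) = mk (fun _ => 0) analyticAt_const := rfl

theorem algebraMap_eq_mk (c : ℂ) :
    algebraMap ℂ HolGerm c = mk (fun _ => c) analyticAt_const :=
  (mk_eq_mk (hF := analyticAt_const (v := c • (1 : ℂ)))).2 (.of_forall fun _ => mul_one c)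

/-- The value of a germ at the origin. -/
noncomputable def eval : HolGerm →ₐ[ℂ] ℂ where
  toFun f := f.1.value
  map_one' := rfl
  map_mul' f g := by
    obtain ⟨F, hF, rfl⟩ := exists_mk f
    obtain ⟨G, hG, rfl⟩ := exists_mk g
    rfl
  map_zero' := rfl
  map_add' f g := by
    obtain ⟨F, hF, rfl⟩ := exists_mk f
    obtain ⟨G, hG, rfl⟩ := exists_mk g
    rfl
  commutes' c := by
    rw [algebraMap_eq_mk]
    rfl

theorem eval_mk {F : ℂ × ℂ → ℂ} (hF : AnalyticAt ℂ F 0) : eval (mk F hF) = F 0 := rfl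

theorem isUnit_iff {f : HolGerm} : IsUnit f ↔ eval f ≠ 0 := by
  refine ⟨fun h => (h.map eval).ne_zero, fun h => ?_⟩
  obtain ⟨F, hF, rfl⟩ := exists_mk f
  refine IsUnit.of_mul_eq_one (mk _ (hF.inv h)) ?_
  rw [mk_mul, one_eq_mk, mk_eq_mk]
  filter_upwards [hF.continuousAt.eventually_ne h] with z hz using mul_inv_cancel₀ hz

instance : IsLocalRing HolGerm :=
  IsLocalRing.of_nonunits_add fun a b ha hb => by
    simp only [mem_nonunits_iff, isUnit_iff, not_not] at *
    simp [ha, hb]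

theorem mem_maximalIdeal {f : HolGerm} : f ∈ IsLocalRing.maximalIdeal HolGerm ↔ eval f = 0 := by
  simp [isUnit_iff]

/-- Identity theorem: if `F` is nonzero at a point of a small ball, `G` vanishes near that point,
hence on the whole ball. -/
instance : IsDomain HolGerm := by
  have : NoZeroDivisors HolGerm := ⟨fun {f g} h => by
    obtain ⟨F, hF, rfl⟩ := exists_mk f
    obtain ⟨G, hG, rfl⟩ := exists_mk g
    rw [mk_mul, zero_eq_mk, mk_eq_mk] at h
    by_contra! hne
    obtain ⟨ε, hε, hε'⟩ := Metric.eventually_nhds_iff_ball.1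
      (hF.eventually_analyticAt.and (hG.eventually_analyticAt.and h))
    have hpre : IsPreconnected (Metric.ball (0 : ℂ × ℂ) ε) :=
      (convex_ball 0 ε).isPreconnected
    have hex : ∃ z ∈ Metric.ball (0 : ℂ × ℂ) ε, F z ≠ 0 := by
      by_contra! hz
      refine hne.1 ?_
      rw [zero_eq_mk, mk_eq_mk]
      filter_upwards [Metric.ball_mem_nhds 0 hε] with z hzε using hz z hzε
    obtain ⟨z, hz, hFz⟩ := hex
    have hG0 : G =ᶠ[𝓝 z] 0 := by
      filter_upwards [(hε' z hz).1.continuousAt.eventually_ne hFz,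
        Metric.isOpen_ball.mem_nhds hz] with w hw hwε
      exact (mul_eq_zero.1 (hε' w hwε).2.2).resolve_left hw
    have := AnalyticOnNhd.eqOn_zero_of_preconnected_of_eventuallyEq_zero
      (fun w hw => (hε' w hw).2.1) hpre hz hG0
    refine hne.2 ?_
    rw [zero_eq_mk, mk_eq_mk]
    filter_upwards [Metric.ball_mem_nhds 0 hε] with w hw using this hw⟩
  have : Nontrivial HolGerm := eval.toRingHom.domain_nontrivial
  exact NoZeroDivisors.to_isDomain _

/-- Composition with an analytic map that fixes the origin. -/
noncomputable def pullback (ψ : ℂ × ℂ → ℂ × ℂ) (hψ : AnalyticAt ℂ ψ 0) (h0 : ψ 0 = 0) :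
    HolGerm →ₐ[ℂ] HolGerm where
  toFun f := ⟨f.1.compTendsto ψ (by simpa only [ContinuousAt, h0] using hψ.continuousAt), by
    obtain ⟨F, hF, rfl⟩ := exists_mk f
    exact ⟨F ∘ ψ, AnalyticAt.comp (by rw [h0]; exact hF) hψ, rfl⟩⟩
  map_one' := rfl
  map_mul' f g := by
    obtain ⟨F, hF, rfl⟩ := exists_mk f
    obtain ⟨G, hG, rfl⟩ := exists_mk g
    rfl
  map_zero' := rfl
  map_add' f g := by
    obtain ⟨F, hF, rfl⟩ := exists_mk f
    obtain ⟨G, hG, rfl⟩ := exists_mk g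
    rfl
  commutes' c := by
    rw [algebraMap_eq_mk]
    rfl

theorem pullback_mk {F : ℂ × ℂ → ℂ} (hF : AnalyticAt ℂ F 0) {ψ : ℂ × ℂ → ℂ × ℂ}
    (hψ : AnalyticAt ℂ ψ 0) (h0 : ψ 0 = 0) :
    pullback ψ hψ h0 (mk F hF) =
      mk (F ∘ ψ) (AnalyticAt.comp (by rw [h0]; exact hF) hψ) := rfl

/-- The germ of the first coordinate function. -/
noncomputable def X : HolGerm := mk Prod.fst analyticAt_fst

/-- The germ of the second coordinate function. -/
noncomputable def Y : HolGerm := mk Prod.snd analyticAt_snd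

/-- Restriction to the line `x = 0`, extended to be constant in `x`. -/
noncomputable def restrX : HolGerm →ₐ[ℂ] HolGerm :=
  pullback ((0 : ℂ × ℂ →L[ℂ] ℂ).prod (ContinuousLinearMap.snd ℂ ℂ ℂ))
    (ContinuousLinearMap.analyticAt _ _) (map_zero _)

/-- Restriction to the line `y = 0`, extended to be constant in `y`. -/
noncomputable def restrY : HolGerm →ₐ[ℂ] HolGerm :=
  pullback ((ContinuousLinearMap.fst ℂ ℂ ℂ).prod (0 : ℂ × ℂ →L[ℂ] ℂ))
    (ContinuousLinearMap.analyticAt _ _) (map_zero _)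

theorem restrX_X : restrX X = 0 := rfl

theorem restrX_Y : restrX Y = Y := rfl

theorem exists_eq_restrX_add (f : HolGerm) : ∃ g, f = restrX f + X * g := by
  obtain ⟨F, hF, rfl⟩ := exists_mk f
  obtain ⟨G, hG, h⟩ := exists_eq_comp_add_mul hF
    ((0 : ℂ × ℂ →L[ℂ] ℂ).prod (ContinuousLinearMap.snd ℂ ℂ ℂ)) (ContinuousLinearMap.fst ℂ ℂ ℂ)
    (1, 0) (fun z => by ext <;> simp)
  exact ⟨mk G hG, by rw [restrX, pullback_mk, X, mk_mul, mk_add, mk_eq_mk]; exact h⟩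

theorem exists_eq_restrY_add (f : HolGerm) : ∃ g, f = restrY f + Y * g := by
  obtain ⟨F, hF, rfl⟩ := exists_mk f
  obtain ⟨G, hG, h⟩ := exists_eq_comp_add_mul hF
    ((ContinuousLinearMap.fst ℂ ℂ ℂ).prod (0 : ℂ × ℂ →L[ℂ] ℂ)) (ContinuousLinearMap.snd ℂ ℂ ℂ)
    (0, 1) (fun z => by ext <;> simp)
  exact ⟨mk G hG, by rw [restrY, pullback_mk, Y, mk_mul, mk_add, mk_eq_mk]; exact h⟩

theorem restrY_restrX (f : HolGerm) : restrY (restrX f) = algebraMap ℂ HolGerm (eval f) := by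
  obtain ⟨F, hF, rfl⟩ := exists_mk f
  rw [algebraMap_eq_mk]
  rfl

theorem Y_ne_zero : Y ≠ 0 := by
  intro h
  rw [Y, zero_eq_mk, mk_eq_mk] at h
  have h1 := h.fderiv_eq (𝕜 := ℂ)
  have h2 : fderiv ℂ (Prod.snd : ℂ × ℂ → ℂ) 0 = ContinuousLinearMap.snd ℂ ℂ ℂ := fderiv_snd
  rw [h2] at h1
  simpa using congrArg (· ((0 : ℂ), (1 : ℂ))) h1

theorem X_dvd_of_dvd_Y_mul {c : HolGerm} (h : X ∣ Y * c) : X ∣ c := by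
  obtain ⟨a, ha⟩ := h
  obtain ⟨g, hg⟩ := exists_eq_restrX_add c
  have h0 : Y * restrX c = 0 := by
    have := congrArg restrX ha
    rwa [map_mul, map_mul, restrX_X, restrX_Y, zero_mul] at this
  rw [(mul_eq_zero.1 h0).resolve_left Y_ne_zero, zero_add] at hg
  exact ⟨g, hg⟩

theorem X_ne_zero : X ≠ 0 := by
  intro h
  rw [X, zero_eq_mk, mk_eq_mk] at h
  have h1 := h.fderiv_eq (𝕜 := ℂ)
  have h2 : fderiv ℂ (Prod.fst : ℂ × ℂ → ℂ) 0 = ContinuousLinearMap.fst ℂ ℂ ℂ := fderiv_fst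
  rw [h2] at h1
  simpa using congrArg (· ((1 : ℂ), (0 : ℂ))) h1

/-- This is all the coprimality of `X` and `Y` that the cancellation argument needs; it stands in
for unique factorisation in `dvd_of_dvd_mul_of_interNum_ne_top`. -/
theorem X_pow_dvd_of_dvd_Y_pow_mul {n k : ℕ} {c : HolGerm} (h : X ^ n ∣ Y ^ k * c) :
    X ^ n ∣ c := by
  have hX : ∀ k c, X ∣ Y ^ k * c → X ∣ c := by
    intro k
    induction k with
    | zero => simp
    | succ k ih =>
      intro c h
      exact ih c (X_dvd_of_dvd_Y_mul (by rwa [pow_succ', mul_assoc] at h))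
  induction n generalizing c with
  | zero => simp
  | succ n ih =>
    obtain ⟨d, rfl⟩ := hX k c ((dvd_pow_self X n.succ_ne_zero).trans h)
    rw [pow_succ'] at h ⊢
    rw [mul_left_comm] at h
    exact mul_dvd_mul_left X (ih ((mul_dvd_mul_iff_left X_ne_zero).1 h))

/-- Divide by `X`, then divide the restriction to `x = 0` by `Y`; the remaining constant is the
value at the origin. -/
theorem maximalIdeal_eq_span : IsLocalRing.maximalIdeal HolGerm = Ideal.span {X, Y} := by
  apply le_antisymm
  · intro f hf
    rw [mem_maximalIdeal] at hf
    obtain ⟨g, hg⟩ := exists_eq_restrX_add f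
    obtain ⟨h, hh⟩ := exists_eq_restrY_add (restrX f)
    rw [restrY_restrX, hf, map_zero, zero_add] at hh
    exact Ideal.mem_span_pair.2 ⟨g, h, by rw [hg, hh]; ring⟩
  · rw [Ideal.span_le]
    rintro _ (rfl | rfl) <;> exact mem_maximalIdeal.2 rfl

/-! ### Derivatives -/

theorem analyticAt_fderiv_apply (v : ℂ × ℂ) {F : ℂ × ℂ → ℂ} (hF : AnalyticAt ℂ F 0) :
    AnalyticAt ℂ (fun p => fderiv ℂ F p v) 0 :=
  ((ContinuousLinearMap.apply ℂ ℂ v).analyticAt _).comp hF.fderiv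

theorem dirDeriv_mk (v : ℂ × ℂ) {F : ℂ × ℂ → ℂ} (hF : AnalyticAt ℂ F 0) :
    dirDeriv v (mk F hF) = mk (fun p => fderiv ℂ F p v) (analyticAt_fderiv_apply v hF) := rfl

/-- The directional derivative as a derivation of the ring of germs. -/
noncomputable def dirDerivation (v : ℂ × ℂ) : Derivation ℂ HolGerm HolGerm :=
  Derivation.mk'
    { toFun := dirDeriv v
      map_add' := fun f g => by
        obtain ⟨F, hF, rfl⟩ := exists_mk f
        obtain ⟨G, hG, rfl⟩ := exists_mk g
        rw [mk_add, dirDeriv_mk, dirDeriv_mk, dirDeriv_mk, mk_add, mk_eq_mk]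
        filter_upwards [hF.eventually_analyticAt, hG.eventually_analyticAt] with z hz hz'
        rw [fderiv_add hz.differentiableAt hz'.differentiableAt]
        rfl
      map_smul' := fun c f => by
        obtain ⟨F, hF, rfl⟩ := exists_mk f
        have h : c • mk F hF = mk (c • F) (hF.const_smul) := rfl
        rw [h, dirDeriv_mk]
        refine (mk_eq_mk (G := c • fun p => fderiv ℂ F p v)
          (hG := (analyticAt_fderiv_apply v hF).const_smul)).2 ?_
        filter_upwards [hF.eventually_analyticAt] with z hz
        rw [fderiv_const_smul hz.differentiableAt]
        rfl }
    fun f g => by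
      obtain ⟨F, hF, rfl⟩ := exists_mk f
      obtain ⟨G, hG, rfl⟩ := exists_mk g
      simp only [LinearMap.coe_mk, AddHom.coe_mk, smul_eq_mul]
      rw [mk_mul, dirDeriv_mk, dirDeriv_mk, dirDeriv_mk, mk_mul, mk_mul, mk_add, mk_eq_mk]
      filter_upwards [hF.eventually_analyticAt, hG.eventually_analyticAt] with z hz hz'
      rw [fderiv_mul hz.differentiableAt hz'.differentiableAt]
      rfl

theorem dx_mul (f g : HolGerm) : dx (f * g) = f * dx g + g * dx f :=
  (dirDerivation (1, 0)).leibniz f g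

theorem dy_mul (f g : HolGerm) : dy (f * g) = f * dy g + g * dy f :=
  (dirDerivation (0, 1)).leibniz f g

theorem dx_add (f g : HolGerm) : dx (f + g) = dx f + dx g := (dirDerivation (1, 0)).map_add f g

theorem dy_add (f g : HolGerm) : dy (f + g) = dy f + dy g := (dirDerivation (0, 1)).map_add f g

theorem dirDeriv_comm (v w : ℂ × ℂ) (f : HolGerm) :
    dirDeriv v (dirDeriv w f) = dirDeriv w (dirDeriv v f) := by
  obtain ⟨F, hF, rfl⟩ := exists_mk f
  rw [dirDeriv_mk, dirDeriv_mk, dirDeriv_mk, dirDeriv_mk, mk_eq_mk]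
  filter_upwards [hF.eventually_analyticAt] with z hz
  have h (v : ℂ × ℂ) : fderiv ℂ (fun p => fderiv ℂ F p v) z =
      (fderiv ℂ (fderiv ℂ F) z).flip v := by
    rw [fderiv_clm_apply hz.fderiv.differentiableAt (differentiableAt_const _)]
    simp
  rw [h, h]
  exact (hz.contDiffAt.isSymmSndFDerivAt_of_omega) v w

theorem dy_dx (f : HolGerm) : dy (dx f) = dx (dy f) := dirDeriv_comm _ _ f

theorem dx_X : dx X = 1 := by
  rw [dx, X, dirDeriv_mk, one_eq_mk, mk_eq_mk]
  refine .of_forall fun z => ?_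
  have h2 : fderiv ℂ (Prod.fst : ℂ × ℂ → ℂ) z = ContinuousLinearMap.fst ℂ ℂ ℂ := fderiv_fst
  simp [h2]

theorem dy_X : dy X = 0 := by
  rw [dy, X, dirDeriv_mk, zero_eq_mk, mk_eq_mk]
  refine .of_forall fun z => ?_
  have h2 : fderiv ℂ (Prod.fst : ℂ × ℂ → ℂ) z = ContinuousLinearMap.fst ℂ ℂ ℂ := fderiv_fst
  simp [h2]

theorem dx_Y : dx Y = 0 := by
  rw [dx, Y, dirDeriv_mk, zero_eq_mk, mk_eq_mk]
  refine .of_forall fun z => ?_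
  have h2 : fderiv ℂ (Prod.snd : ℂ × ℂ → ℂ) z = ContinuousLinearMap.snd ℂ ℂ ℂ := fderiv_snd
  simp [h2]

theorem dy_Y : dy Y = 1 := by
  rw [dy, Y, dirDeriv_mk, one_eq_mk, mk_eq_mk]
  refine .of_forall fun z => ?_
  have h2 : fderiv ℂ (Prod.snd : ℂ × ℂ → ℂ) z = ContinuousLinearMap.snd ℂ ℂ ℂ := fderiv_snd
  simp [h2]

/-- The chain rule. -/
theorem dirDeriv_pullback {ψ : ℂ × ℂ → ℂ × ℂ} (hψ : AnalyticAt ℂ ψ 0) (h0 : ψ 0 = 0)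
    (v : ℂ × ℂ) (f : HolGerm) :
    dirDeriv v (pullback ψ hψ h0 f) =
      pullback ψ hψ h0 (dx f) * dirDeriv v (pullback ψ hψ h0 X) +
        pullback ψ hψ h0 (dy f) * dirDeriv v (pullback ψ hψ h0 Y) := by
  obtain ⟨F, hF, rfl⟩ := exists_mk f
  simp only [dx, dy, X, Y, pullback_mk, dirDeriv_mk, mk_mul, mk_add, mk_eq_mk]
  have ht : Tendsto ψ (𝓝 0) (𝓝 0) := by simpa only [ContinuousAt, h0] using hψ.continuousAt
  filter_upwards [ht.eventually hF.eventually_analyticAt, hψ.eventually_analyticAt] with z hz hz'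
  have h1 : fderiv ℂ (F ∘ ψ) z = (fderiv ℂ F (ψ z)).comp (fderiv ℂ ψ z) :=
    fderiv_comp z hz.differentiableAt hz'.differentiableAt
  have h2 : fderiv ℂ (Prod.fst ∘ ψ) z =
      (ContinuousLinearMap.fst ℂ ℂ ℂ).comp (fderiv ℂ ψ z) :=
    (hasFDerivAt_fst.comp z hz'.differentiableAt.hasFDerivAt).fderiv
  have h3 : fderiv ℂ (Prod.snd ∘ ψ) z =
      (ContinuousLinearMap.snd ℂ ℂ ℂ).comp (fderiv ℂ ψ z) :=
    (hasFDerivAt_snd.comp z hz'.differentiableAt.hasFDerivAt).fderiv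
  simp only [h1, h2, h3, Pi.add_apply, Pi.mul_apply, Function.comp_apply,
    ContinuousLinearMap.comp_apply, ContinuousLinearMap.coe_fst', ContinuousLinearMap.coe_snd']
  generalize fderiv ℂ ψ z v = w
  have hw : w = w.1 • ((1 : ℂ), (0 : ℂ)) + w.2 • ((0 : ℂ), (1 : ℂ)) := by ext <;> simp
  conv_lhs => rw [hw]
  rw [map_add, map_smul, map_smul, smul_eq_mul, smul_eq_mul]
  ring

end HolGerm
end PlaneCurve

/-! ### Biholomorphic germs and their Jacobians -/

namespace PlaneCurve
open HolGerm

/-- The Jacobian determinant of the map germ `(p, q)`. -/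
noncomputable def jac (p q : HolGerm) : HolGerm := dx p * dy q - dy p * dx q

namespace Biholo

/-- The inverse germ. -/
def symm (φ : Biholo) : Biholo where
  toFun := φ.invFun
  invFun := φ.toFun
  analytic_toFun := φ.analytic_invFun
  analytic_invFun := φ.analytic_toFun
  map_zero := φ.inv_zero
  inv_zero := φ.map_zero
  left_inv := φ.right_inv
  right_inv := φ.left_inv

/-- Composition with `φ`. -/
noncomputable def pull (φ : Biholo) : HolGerm →ₐ[ℂ] HolGerm :=
  pullback φ.toFun φ.analytic_toFun φ.map_zero

theorem compInv_eq (φ : Biholo) (f : HolGerm) : compInv f φ = φ.symm.pull f := rfl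

theorem pull_pull_symm (φ : Biholo) (f : HolGerm) : φ.pull (φ.symm.pull f) = f := by
  obtain ⟨F, hF, rfl⟩ := exists_mk f
  simp only [pull, pullback_mk, mk_eq_mk]
  filter_upwards [φ.left_inv] with z hz
  simp [symm, hz]

/-- Composition with `φ` as an automorphism. -/
noncomputable def pullEquiv (φ : Biholo) : HolGerm ≃ₐ[ℂ] HolGerm :=
  AlgEquiv.ofAlgHom φ.pull φ.symm.pull (AlgHom.ext φ.pull_pull_symm)
    (AlgHom.ext φ.symm.pull_pull_symm)

theorem pullEquiv_apply (φ : Biholo) (f : HolGerm) : φ.pullEquiv f = φ.pull f := rfl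

theorem eval_pull (φ : Biholo) (f : HolGerm) : eval (φ.pull f) = eval f := by
  obtain ⟨F, hF, rfl⟩ := exists_mk f
  rw [pull, pullback_mk, eval_mk, eval_mk, Function.comp_apply, φ.map_zero]

theorem dx_pull (φ : Biholo) (f : HolGerm) :
    dx (φ.pull f) = φ.pull (dx f) * dx (φ.pull X) + φ.pull (dy f) * dx (φ.pull Y) :=
  dirDeriv_pullback _ _ _ f

theorem dy_pull (φ : Biholo) (f : HolGerm) :
    dy (φ.pull f) = φ.pull (dx f) * dy (φ.pull X) + φ.pull (dy f) * dy (φ.pull Y) :=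
  dirDeriv_pullback _ _ _ f

theorem jac_pull (φ : Biholo) (f g : HolGerm) :
    jac (φ.pull f) (φ.pull g) = φ.pull (jac f g) * jac (φ.pull X) (φ.pull Y) := by
  simp only [jac, map_sub, map_mul]
  rw [dx_pull φ f, dy_pull φ g, dy_pull φ f, dx_pull φ g]
  ring

/-- Multiplicativity of Jacobians applied to the components of the inverse map: their pullbacks are
`X` and `Y`, whose Jacobian is 1. -/
theorem isUnit_jac (φ : Biholo) : IsUnit (jac (φ.pull X) (φ.pull Y)) := by
  have h := φ.jac_pull (φ.symm.pull X) (φ.symm.pull Y)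
  rw [pull_pull_symm, pull_pull_symm, jac, dx_X, dy_Y, dy_X, zero_mul, sub_zero, one_mul,
    mul_comm] at h
  exact IsUnit.of_mul_eq_one _ h.symm

/-- The inverse function theorem. -/
theorem exists_pull_eq {p q : HolGerm} (hp : eval p = 0) (hq : eval q = 0)
    (hpq : eval (jac p q) ≠ 0) : ∃ φ : Biholo, φ.pull X = p ∧ φ.pull Y = q := by
  obtain ⟨P, hP, rfl⟩ := exists_mk p
  obtain ⟨Q, hQ, rfl⟩ := exists_mk q
  have hPQ : AnalyticAt ℂ (fun z => (P z, Q z)) 0 := hP.prod hQ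
  have h0 : (P 0, Q 0) = (0 : ℂ × ℂ) := Prod.ext hp hq
  have hd := hPQ.hasStrictFDerivAt
  have hker : ∀ v, fderiv ℂ (fun z => (P z, Q z)) 0 v = 0 → v = 0 := by
    intro v hv
    rw [(hP.differentiableAt.hasFDerivAt.prodMk hQ.differentiableAt.hasFDerivAt).fderiv] at hv
    have hv1 : fderiv ℂ P 0 v = 0 := congrArg Prod.fst hv
    have hv2 : fderiv ℂ Q 0 v = 0 := congrArg Prod.snd hv
    have hw : v = v.1 • ((1 : ℂ), (0 : ℂ)) + v.2 • ((0 : ℂ), (1 : ℂ)) := by ext <;> simp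
    rw [hw, map_add, map_smul, map_smul, smul_eq_mul, smul_eq_mul] at hv1 hv2
    have hJ : fderiv ℂ P 0 (1, 0) * fderiv ℂ Q 0 (0, 1) -
      fderiv ℂ P 0 (0, 1) * fderiv ℂ Q 0 (1, 0) ≠ 0 := hpq
    -- Cramer's rule for the two linear equations `hv1` and `hv2`.
    ext
    · refine (mul_eq_zero.1 ?_).resolve_right hJ
      linear_combination fderiv ℂ Q 0 (0, 1) * hv1 - fderiv ℂ P 0 (0, 1) * hv2
    · refine (mul_eq_zero.1 ?_).resolve_right hJ
      linear_combination fderiv ℂ P 0 (1, 0) * hv2 - fderiv ℂ Q 0 (1, 0) * hv1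
  let e : (ℂ × ℂ) ≃L[ℂ] (ℂ × ℂ) :=
    (LinearEquiv.ofInjectiveEndo (fderiv ℂ (fun z => (P z, Q z)) 0 : ℂ × ℂ →ₗ[ℂ] ℂ × ℂ)
      (LinearMap.ker_eq_bot.1 (LinearMap.ker_eq_bot'.2 hker))).toContinuousLinearEquiv
  have he : (e : ℂ × ℂ →L[ℂ] ℂ × ℂ) = fderiv ℂ (fun z => (P z, Q z)) 0 := by
    ext <;> rfl
  rw [← he] at hd
  have hinv : hd.localInverse _ e 0 0 = 0 := by
    have := hd.localInverse_apply_image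
    rwa [h0] at this
  refine ⟨⟨fun z => (P z, Q z), hd.localInverse _ e 0, hPQ, ?_, h0, hinv, ?_, ?_⟩, rfl, rfl⟩
  · have := (hd.toOpenPartialHomeomorph _).analyticAt_symm' (i := e)
      hd.mem_toOpenPartialHomeomorph_source hPQ he.symm
    change AnalyticAt ℂ (hd.localInverse _ e 0) (P 0, Q 0) at this
    rwa [h0] at this
  · exact hd.eventually_left_inverse
  · have := hd.eventually_right_inverse
    rwa [h0] at this

end Biholo

/-! ### The curvature and vertex expressions of a vector field -/

section
variable {R : Type*} [CommRing R]

/-- The expression `γ' ∧ γ''` along the integral curves of `D`, with `γ = (p, q)`. -/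
def inflExpr (D : R → R) (p q : R) : R := D p * D (D q) - D q * D (D p)

/-- The expression `(γ' · γ') (γ' ∧ γ''') - 3 (γ' · γ'') (γ' ∧ γ'')` along the integral curves
of `D`, with `γ = (p, q)`. -/
def vertExpr (D : R → R) (p q : R) : R :=
  (D p ^ 2 + D q ^ 2) * (D p * D (D (D q)) - D q * D (D (D p))) -
    3 * (D p * D (D p) + D q * D (D q)) * (D p * D (D q) - D q * D (D p))

/-- Reparametrisation: `D (D a)` is `u ^ 2 * E (E a)` plus a multiple of `E a`, and the latter drops
out of the wedge with the velocity. -/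
theorem inflExpr_mul {D E : R → R} (hE : ∀ a b, E (a * b) = a * E b + b * E a) {u : R}
    (hD : ∀ a, D a = u * E a) (p q : R) : inflExpr D p q = u ^ 3 * inflExpr E p q := by
  simp only [inflExpr, hD, hE]
  ring

/-- The third derivative contributes an extra `3 * u ^ 2 * E u` times the second; the coefficient 3
of the correction term is what cancels it. -/
theorem vertExpr_mul {D E : R → R} (hE : ∀ a b, E (a * b) = a * E b + b * E a)
    (hadd : ∀ a b, E (a + b) = E a + E b) {u : R}
    (hD : ∀ a, D a = u * E a) (p q : R) : vertExpr D p q = u ^ 6 * vertExpr E p q := by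
  simp only [vertExpr, hD, hE, hadd]
  ring

theorem map_inflExpr {S : Type*} [CommRing S] (π : R →+* S) {D : R → R} {E : S → S}
    (h : ∀ a, π (D a) = E (π a)) (p q : R) :
    π (inflExpr D p q) = inflExpr E (π p) (π q) := by
  simp only [inflExpr, map_sub, map_mul, h]

theorem map_vertExpr {S : Type*} [CommRing S] (π : R →+* S) {D : R → R} {E : S → S}
    (h : ∀ a, π (D a) = E (π a)) (p q : R) :
    π (vertExpr D p q) = vertExpr E (π p) (π q) := by
  simp only [vertExpr, map_sub, map_add, map_mul, map_pow, h, map_ofNat]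

end

/-- The Hamiltonian vector field of `f`, tangent to the level curves of `f`. -/
noncomputable def tangentField (f g : HolGerm) : HolGerm := jac g f

theorem tangentField_mul (f a b : HolGerm) :
    tangentField f (a * b) = a * tangentField f b + b * tangentField f a := by
  simp only [tangentField, jac, dx_mul, dy_mul]
  ring

theorem tangentField_add (f a b : HolGerm) :
    tangentField f (a + b) = tangentField f a + tangentField f b := by
  simp only [tangentField, jac, dx_add, dy_add]
  ring

theorem tangentField_smul (f : HolGerm) (c : ℂ) (a : HolGerm) :
    tangentField f (c • a) = c • tangentField f a := by
  have h1 : dx (c • a) = c • dx a := (dirDerivation (1, 0)).map_smul c a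
  have h2 : dy (c • a) = c • dy a := (dirDerivation (0, 1)).map_smul c a
  simp only [tangentField, jac, h1, h2, smul_mul_assoc, smul_sub]

theorem tangentField_neg (f a : HolGerm) : tangentField f (-a) = -tangentField f a := by
  have := tangentField_smul f (-1) a
  rwa [neg_one_smul, neg_one_smul] at this

theorem tangentField_X (f : HolGerm) : tangentField f X = dy f := by
  simp [tangentField, jac, dx_X, dy_X]

theorem tangentField_Y (f : HolGerm) : tangentField f Y = -dx f := by
  simp [tangentField, jac, dx_Y, dy_Y]

theorem inflGerm_eq (f : HolGerm) : inflGerm f = -inflExpr (tangentField f) X Y := by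
  simp only [inflExpr, tangentField_X, tangentField_Y, tangentField_neg, inflGerm]
  simp only [tangentField, jac, dy_dx]
  ring

theorem dx_sub (f g : HolGerm) : dx (f - g) = dx f - dx g := (dirDerivation (1, 0)).map_sub f g

theorem dy_sub (f g : HolGerm) : dy (f - g) = dy f - dy g := (dirDerivation (0, 1)).map_sub f g

theorem vertGerm_eq (f : HolGerm) : vertGerm f = vertExpr (tangentField f) X Y := by
  simp only [vertExpr, tangentField_X, tangentField_Y, tangentField_neg, vertGerm]
  simp only [tangentField, jac, dx_sub, dy_sub, dx_mul, dy_mul, dy_dx]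
  ring

end PlaneCurve

/-! ### Colength of ideals and spanning families -/

namespace PlaneCurve

section Colength
variable {K R : Type*} [Field K] [CommRing R] [Algebra K R]

open IsLocalRing in
/-- A power of the maximal ideal of exponent at least the colength of an ideal lies in it. -/
theorem maximalIdeal_pow_le_of_finrank_le [IsLocalRing R] (hm : (maximalIdeal R).FG)
    (J : Ideal R) [Module.Finite K (R ⧸ J)] {n : ℕ} (hn : Module.finrank K (R ⧸ J) ≤ n) :
    maximalIdeal R ^ n ≤ J := by
  let N : ℕ → Submodule R (R ⧸ J) := fun i => Submodule.map J.mkQ (maximalIdeal R ^ i)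
  have hN (i : ℕ) : N (i + 1) = maximalIdeal R • N i := by
    change Submodule.map _ _ = _ • Submodule.map _ _
    rw [← Submodule.map_smul'', smul_eq_mul, pow_succ']
  -- Multiplying by the maximal ideal either lowers the dimension strictly or, by Nakayama, the
  -- module is already zero. The subtraction is truncated, so `i = n` gives dimension 0.
  have key (i : ℕ) : Module.finrank K ((N i).restrictScalars K) ≤ n - i := by
    induction i with
    | zero => exact (Submodule.finrank_le _).trans hn
    | succ i ih =>
      by_cases h : N i ≤ N (i + 1)
      · have hbot : N i = ⊥ := by
          refine Submodule.eq_bot_of_le_smul_of_le_jacobson_bot (maximalIdeal R) _ ?_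
            (h.trans (hN i).le) (maximalIdeal_le_jacobson _)
          exact Submodule.FG.map _ (Submodule.FG.pow hm i)
        rw [hN, hbot, Submodule.smul_bot, Submodule.restrictScalars_bot, finrank_bot]
        exact Nat.zero_le _
      · have hlt : (N (i + 1)).restrictScalars K < (N i).restrictScalars K := by
          refine lt_of_le_not_ge ?_ h
          rw [hN]
          exact Submodule.smul_le_right
        have := Submodule.finrank_lt_finrank_of_lt hlt
        omega
  have h0 := key n
  rw [Nat.sub_self, Nat.le_zero, Submodule.finrank_eq_zero,
    Submodule.restrictScalars_eq_bot_iff] at h0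
  change Submodule.map J.mkQ (maximalIdeal R ^ n) = ⊥ at h0
  rwa [← LinearMap.le_ker_iff_map, Submodule.ker_mkQ] at h0

/-- The family `e` spans the quotient by `J`. -/
def SpansModulo (K : Type*) {R : Type*} [Field K] [CommRing R] [Algebra K R] {n : ℕ}
    (e : Fin n → R) (J : Ideal R) : Prop :=
  ∀ r : R, ∃ c : Fin n → K, r - ∑ i, c i • e i ∈ J

theorem exists_spansModulo (J : Ideal R) [Module.Finite K (R ⧸ J)] :
    ∃ e : Fin (Module.finrank K (R ⧸ J)) → R, SpansModulo K e J := by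
  let b := Module.finBasis K (R ⧸ J)
  choose e he using fun i => Ideal.Quotient.mk_surjective (b i)
  refine ⟨e, fun r => ⟨b.repr (Ideal.Quotient.mk J r), ?_⟩⟩
  rw [← Ideal.Quotient.eq_zero_iff_mem, map_sub, sub_eq_zero]
  conv_lhs => rw [← b.sum_repr (Ideal.Quotient.mk J r)]
  rw [map_sum]
  refine Finset.sum_congr rfl fun i _ => ?_
  rw [← he i]
  rfl

theorem SpansModulo.finite {n : ℕ} {e : Fin n → R} {J : Ideal R} (h : SpansModulo K e J) :
    Module.Finite K (R ⧸ J) ∧ Module.finrank K (R ⧸ J) ≤ n := by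
  let T : (Fin n → K) →ₗ[K] R ⧸ J :=
    (Ideal.Quotient.mkₐ K J).toLinearMap ∘ₗ Fintype.linearCombination K e
  have hT : Function.Surjective T := by
    intro x
    obtain ⟨r, rfl⟩ := Ideal.Quotient.mk_surjective x
    obtain ⟨c, hc⟩ := h r
    exact ⟨c, ((Ideal.Quotient.mk_eq_mk_iff_sub_mem _ _).2 hc).symm⟩
  exact ⟨Module.Finite.of_surjective T hT,
    (LinearMap.finrank_le_finrank_of_surjective hT).trans (by simp)⟩

theorem SpansModulo.mono {n : ℕ} {e : Fin n → R} {I J : Ideal R} (h : SpansModulo K e I)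
    (hIJ : I ≤ J) : SpansModulo K e J := fun r => (h r).imp fun _ hc => hIJ hc

/-- Apply `l` to each coefficient: powers of a scalar of `K` pass through a linear functional. -/
theorem exists_polynomial_apply (l : R →ₗ[K] K) (Q : Polynomial R) :
    ∃ q : Polynomial K, ∀ s, q.eval s = l (Q.eval (algebraMap K R s)) := by
  refine ⟨∑ i ∈ Finset.range (Q.natDegree + 1), Polynomial.monomial i (l (Q.coeff i)),
    fun s => ?_⟩
  rw [Polynomial.eval_finsetSum, Polynomial.eval_eq_sum_range, map_sum]
  refine Finset.sum_congr rfl fun i _ => ?_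
  rw [Polynomial.eval_monomial, ← map_pow, mul_comm (Q.coeff i), ← Algebra.smul_def, map_smul,
    smul_eq_mul, mul_comm]

theorem eventually_cofinite_eval_ne_zero {d : Polynomial K} {s₀ : K} (h : d.eval s₀ ≠ 0) :
    ∀ᶠ s in cofinite, d.eval s ≠ 0 := by
  classical
  have hd : d ≠ 0 := by rintro rfl; simp at h
  refine (d.roots.toFinset.finite_toSet).subset fun s hs => ?_
  have hs' : d.eval s = 0 := by simpa using hs
  simpa [hd] using hs'

/-- If a family spans modulo one member of a polynomial family of ideals `⟨f, P s⟩`, then it spans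
modulo almost every member, up to an ideal of finite colength. -/
theorem SpansModulo.eventually {n : ℕ} {e : Fin n → R} {f : R} {P : Polynomial R} {s₀ : K}
    (h : SpansModulo K e (Ideal.span {f, P.eval (algebraMap K R s₀)})) (M : Ideal R)
    [Module.Finite K (R ⧸ M)] :
    ∀ᶠ s in cofinite,
      SpansModulo K e (Ideal.span {f, P.eval (algebraMap K R s)} ⊔ M) := by
  let b := Module.finBasis K (R ⧸ M)
  choose r hr using fun i => Ideal.Quotient.mk_surjective (b i)
  choose c hc using fun i => h (r i)
  choose u v huv using fun i => Ideal.mem_span_pair.1 (hc i)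
  -- Each basis lift `r i` is a combination of the `e j` plus `u i * f + v i * P(s₀)`. Replacing
  -- `P(s₀)` by `P(s)` deforms it within the span of `e` modulo the deformed ideal. The coordinate
  -- determinant modulo `M` is polynomial in `s` and equals 1 at `s₀`.
  let Q : Fin (Module.finrank K (R ⧸ M)) → Polynomial R := fun i =>
    Polynomial.C (∑ j, c i j • e j + u i * f) + Polynomial.C (v i) * P
  have hQ (i) (s : K) : (Q i).eval (algebraMap K R s) =
      ∑ j, c i j • e j + u i * f + v i * P.eval (algebraMap K R s) := by
    simp [Q, Polynomial.eval_finsetSum]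
  have hQ₀ (i) : (Q i).eval (algebraMap K R s₀) = r i := by
    rw [hQ, add_assoc, huv]
    ring
  choose q hq using fun i j =>
    exists_polynomial_apply (b.coord j ∘ₗ (Ideal.Quotient.mkₐ K M).toLinearMap) (Q i)
  let A : Matrix _ _ (Polynomial K) := Matrix.of q
  have hA (s : K) : A.det.eval s =
      b.det fun i => Ideal.Quotient.mk M ((Q i).eval (algebraMap K R s)) := by
    rw [Module.Basis.det_apply, ← Polynomial.coe_evalRingHom, RingHom.map_det,
      ← Matrix.det_transpose]
    congr 1
    ext i j
    simp [A, hq, Module.Basis.toMatrix_apply]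
  have h₀ : A.det.eval s₀ ≠ 0 := by
    have : (fun i => Ideal.Quotient.mk M ((Q i).eval (algebraMap K R s₀))) = b :=
      funext fun i => by rw [hQ₀, hr]
    rw [hA, this, Module.Basis.det_self]
    exact one_ne_zero
  filter_upwards [eventually_cofinite_eval_ne_zero h₀] with s hs
  rw [hA, ← isUnit_iff_ne_zero, ← Module.Basis.is_basis_iff_det] at hs
  intro x
  have hx : Ideal.Quotient.mk M x ∈ Submodule.span K (Set.range fun i =>
      Ideal.Quotient.mk M ((Q i).eval (algebraMap K R s))) := by
    rw [hs.2]
    trivial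
  obtain ⟨a, ha⟩ := (Submodule.mem_span_range_iff_exists_fun K).1 hx
  have hxa : x - ∑ i, a i • (Q i).eval (algebraMap K R s) ∈ M := by
    rw [← Ideal.Quotient.eq_zero_iff_mem, map_sub, sub_eq_zero, ← ha, map_sum]
    rfl
  refine ⟨fun j => ∑ i, a i * c i j, ?_⟩
  have hsum : x - ∑ j, (∑ i, a i * c i j) • e j =
      ∑ i, a i • (u i * f + v i * P.eval (algebraMap K R s)) +
        (x - ∑ i, a i • (Q i).eval (algebraMap K R s)) := by
    simp only [hQ, add_assoc, smul_add, Finset.sum_add_distrib, Finset.smul_sum, Finset.sum_smul,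
      mul_smul]
    rw [Finset.sum_comm]
    ring
  rw [hsum]
  refine Submodule.add_mem_sup (Submodule.sum_mem _ fun i _ => ?_) hxa
  rw [Algebra.smul_def]
  exact Ideal.mul_mem_left _ _ (Ideal.mem_span_pair.2 ⟨_, _, rfl⟩)

theorem span_pair_mul_le {R : Type*} [CommRing R] (f g h : R) :
    Ideal.span {f, g * h} ≤ Ideal.span {f, g} := by
  rw [Ideal.span_le]
  rintro _ (rfl | rfl)
  · exact Ideal.subset_span (by simp)
  · exact Ideal.mul_mem_right _ _ (Ideal.subset_span (by simp))

/-- Multiplication by `g` gives an exact sequence `0 → R/(f, h) → R/(f, gh) → R/(f, g) → 0`; `hreg`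
is what makes the first map injective. -/
theorem rank_quotient_span_pair_mul {f g : R} (hreg : ∀ a, f ∣ g * a → f ∣ a) (h : R) :
    Module.rank K (R ⧸ Ideal.span {f, g * h}) =
      Module.rank K (R ⧸ Ideal.span {f, g}) + Module.rank K (R ⧸ Ideal.span {f, h}) := by
  let σ : (R ⧸ Ideal.span {f, g * h}) →ₐ[R] (R ⧸ Ideal.span {f, g}) :=
    Ideal.Quotient.factorₐ R (span_pair_mul_le f g h)
  have hσ : Function.Surjective σ := Ideal.Quotient.factor_surjective (span_pair_mul_le f g h)
  let μ : R →ₗ[R] (R ⧸ Ideal.span {f, g * h}) :=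
    (Ideal.span {f, g * h}).mkQ ∘ₗ LinearMap.mulLeft R g
  have hker : LinearMap.ker μ = Ideal.span {f, h} := by
    ext a
    change Submodule.Quotient.mk (g * a) = (0 : R ⧸ Ideal.span {f, g * h}) ↔ _
    rw [Submodule.Quotient.mk_eq_zero, Ideal.mem_span_pair, Ideal.mem_span_pair]
    constructor
    · rintro ⟨c, d, hcd⟩
      obtain ⟨b, hb⟩ := hreg (a - d * h) ⟨c, by linear_combination -hcd⟩
      exact ⟨b, d, by linear_combination -hb⟩
    · rintro ⟨c, d, rfl⟩
      exact ⟨g * c, d, by ring⟩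
  have hrange : LinearMap.range μ = LinearMap.ker σ.toLinearMap := by
    ext x
    obtain ⟨a, rfl⟩ := Ideal.Quotient.mk_surjective x
    have h1 : Ideal.Quotient.mk (Ideal.span {f, g * h}) a ∈ LinearMap.ker σ.toLinearMap ↔
        a ∈ Ideal.span {f, g} := by
      change Ideal.Quotient.mk (Ideal.span {f, g}) a = 0 ↔ _
      exact Ideal.Quotient.eq_zero_iff_mem
    rw [h1, Ideal.mem_span_pair]
    constructor
    · rintro ⟨b, hb⟩
      change Ideal.Quotient.mk _ (g * b) = _ at hb
      rw [Ideal.Quotient.eq, Ideal.mem_span_pair] at hb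
      obtain ⟨c, d, hcd⟩ := hb
      exact ⟨-c, b - d * h, by linear_combination -hcd⟩
    · rintro ⟨c, d, rfl⟩
      refine ⟨d, ?_⟩
      change Ideal.Quotient.mk _ (g * d) = _
      rw [Ideal.Quotient.eq, Ideal.mem_span_pair]
      exact ⟨-c, 0, by ring⟩
  have e1 : (R ⧸ Ideal.span {f, h}) ≃ₗ[R] LinearMap.ker σ.toLinearMap :=
    (Submodule.quotEquivOfEq _ _ hker.symm).trans
      (μ.quotKerEquivRange.trans (LinearEquiv.ofEq _ _ hrange))
  have e2 : LinearMap.range σ.toLinearMap ≃ₗ[R] (R ⧸ Ideal.span {f, g}) :=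
    LinearEquiv.ofTop _ (LinearMap.range_eq_top.2 hσ)
  have hrank := (σ.toLinearMap.restrictScalars K).rank_range_add_rank_ker
  have h1 : Module.rank K (LinearMap.ker (σ.toLinearMap.restrictScalars K)) =
      Module.rank K (R ⧸ Ideal.span {f, h}) :=
    (e1.restrictScalars K).rank_eq.symm
  have h2 : Module.rank K (LinearMap.range (σ.toLinearMap.restrictScalars K)) =
      Module.rank K (R ⧸ Ideal.span {f, g}) :=
    (e2.restrictScalars K).rank_eq
  rw [h1, h2] at hrank
  exact hrank.symm

end Colength

/-! ### Finite colength and semicontinuity of intersection numbers -/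

namespace HolGerm

theorem maximalIdeal_fg : (IsLocalRing.maximalIdeal HolGerm).FG := by
  rw [maximalIdeal_eq_span]
  exact Submodule.fg_span (Set.toFinite _)

instance finite_quotient_maximalIdeal_pow (k : ℕ) :
    Module.Finite ℂ (HolGerm ⧸ IsLocalRing.maximalIdeal HolGerm ^ k) := by
  have hX : X ∈ IsLocalRing.maximalIdeal HolGerm := mem_maximalIdeal.2 rfl
  have hY : Y ∈ IsLocalRing.maximalIdeal HolGerm := mem_maximalIdeal.2 rfl
  obtain ⟨V, hV, h⟩ : ∃ V : Submodule ℂ HolGerm, V.FG ∧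
      ∀ f, ∃ v ∈ V, f - v ∈ IsLocalRing.maximalIdeal HolGerm ^ k := by
    induction k with
    | zero => exact ⟨⊥, Submodule.fg_bot, fun f => ⟨0, rfl, by simp⟩⟩
    | succ k ih =>
      obtain ⟨V, hV, h⟩ := ih
      refine ⟨ℂ ∙ (1 : HolGerm) ⊔ (V.map (LinearMap.mulLeft ℂ X) ⊔
        V.map (LinearMap.mulLeft ℂ Y)), (Submodule.fg_span_singleton _).sup
          ((hV.map _).sup (hV.map _)), fun f => ?_⟩
      have hf : f - algebraMap ℂ HolGerm (eval f) ∈ IsLocalRing.maximalIdeal HolGerm := by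
        rw [mem_maximalIdeal, map_sub, AlgHom.commutes]
        exact sub_self _
      rw [maximalIdeal_eq_span] at hf
      obtain ⟨a, b, hab⟩ := Ideal.mem_span_pair.1 hf
      obtain ⟨v, hv, hav⟩ := h a
      obtain ⟨w, hw, hbw⟩ := h b
      refine ⟨algebraMap ℂ HolGerm (eval f) + (X * v + Y * w),
        Submodule.add_mem_sup ?_ (Submodule.add_mem_sup ⟨v, hv, rfl⟩ ⟨w, hw, rfl⟩), ?_⟩
      · exact Submodule.mem_span_singleton.2 ⟨eval f, (Algebra.algebraMap_eq_smul_one _).symm⟩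
      · have : f - (algebraMap ℂ HolGerm (eval f) + (X * v + Y * w)) =
            X * (a - v) + Y * (b - w) := by
          linear_combination -hab
        rw [this, pow_succ']
        exact Ideal.add_mem _ (Ideal.mul_mem_mul hX hav) (Ideal.mul_mem_mul hY hbw)
  have : Module.Finite ℂ V := Module.Finite.iff_fg.2 hV
  refine Module.Finite.of_surjective
    ((Ideal.Quotient.mkₐ ℂ (IsLocalRing.maximalIdeal HolGerm ^ k)).toLinearMap ∘ₗ V.subtype)
    fun x => ?_
  obtain ⟨f, rfl⟩ := Ideal.Quotient.mk_surjective x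
  obtain ⟨v, hv, hfv⟩ := h f
  exact ⟨⟨v, hv⟩, ((Ideal.Quotient.mk_eq_mk_iff_sub_mem _ _).2 hfv).symm⟩

end HolGerm

open HolGerm

theorem interNum_eq_finrank (f g : HolGerm) [Module.Finite ℂ (HolGerm ⧸ Ideal.span {f, g})] :
    interNum f g = Module.finrank ℂ (HolGerm ⧸ Ideal.span {f, g}) := by
  rw [interNum, ← Module.finrank_eq_rank, Cardinal.toENat_nat]

theorem finite_of_interNum_ne_top {f g : HolGerm} (h : interNum f g ≠ ⊤) :
    Module.Finite ℂ (HolGerm ⧸ Ideal.span {f, g}) := by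
  rw [interNum, Ne, Cardinal.toENat_eq_top, not_le] at h
  have : Module.Free ℂ (HolGerm ⧸ Ideal.span {f, g}) := Module.Free.of_divisionRing _ _
  exact Module.rank_lt_aleph0_iff.1 h

/-- The intersection number is upper semicontinuous in polynomial families. -/
theorem eventually_interNum_le (f : HolGerm) (P : Polynomial HolGerm) (s₀ : ℂ) :
    ∀ᶠ s in cofinite, interNum f (P.eval (algebraMap ℂ HolGerm s)) ≤
      interNum f (P.eval (algebraMap ℂ HolGerm s₀)) := by
  by_cases htop : interNum f (P.eval (algebraMap ℂ HolGerm s₀)) = ⊤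
  · simp [htop]
  have := finite_of_interNum_ne_top htop
  rw [interNum_eq_finrank f (P.eval (algebraMap ℂ HolGerm s₀))]
  obtain ⟨e, he⟩ := exists_spansModulo (K := ℂ)
    (Ideal.span {f, P.eval (algebraMap ℂ HolGerm s₀)})
  generalize Module.finrank ℂ (HolGerm ⧸ Ideal.span {f, P.eval (algebraMap ℂ HolGerm s₀)}) = n
    at e he ⊢
  -- Working modulo the power `n + 1` makes the deformation finite-dimensional. The resulting ideal
  -- has colength at most `n`, so it contains the `n`-th power; Nakayama then removes the auxiliary
  -- summand.
  filter_upwards [he.eventually (IsLocalRing.maximalIdeal HolGerm ^ (n + 1))] with s hs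
  obtain ⟨hfin, hle⟩ := hs.finite
  have h1 := maximalIdeal_pow_le_of_finrank_le (K := ℂ) maximalIdeal_fg _ hle
  rw [pow_succ'] at h1
  have h2 := Submodule.le_of_le_smul_of_le_jacobson_bot (Submodule.FG.pow maximalIdeal_fg n)
    (IsLocalRing.maximalIdeal_le_jacobson _) h1
  have h3 := hs.mono (sup_le le_rfl ((Ideal.pow_le_pow_right n.le_succ).trans h2))
  obtain ⟨hfin', hle'⟩ := h3.finite
  rw [interNum_eq_finrank]
  exact_mod_cast hle'

/-! ### Formal properties of the intersection number -/

theorem interNum_comm (f g : HolGerm) : interNum f g = interNum g f := by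
  rw [interNum, interNum, Set.pair_comm]

theorem interNum_eq_of_span_eq {f g f' g' : HolGerm}
    (h : Ideal.span {f, g} = Ideal.span {f', g'}) : interNum f g = interNum f' g' := by
  rw [interNum, interNum, h]

theorem interNum_congr {f a b : HolGerm} (h : f ∣ a - b) : interNum f a = interNum f b := by
  obtain ⟨c, hc⟩ := h
  obtain rfl : a = b + c * f := by rw [mul_comm, ← hc]; ring
  exact interNum_eq_of_span_eq (Ideal.span_pair_add_mul_left _ _ _)

theorem interNum_mul_unit_right {f g u : HolGerm} (hu : IsUnit u) :
    interNum f (u * g) = interNum f g := by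
  refine interNum_eq_of_span_eq ?_
  rw [Ideal.span_insert, Ideal.span_insert, Ideal.span_singleton_mul_left_unit hu]

theorem interNum_mul_unit_left {f g u : HolGerm} (hu : IsUnit u) :
    interNum (u * f) g = interNum f g := by
  rw [interNum_comm, interNum_mul_unit_right hu, interNum_comm]

theorem interNum_map (e : HolGerm ≃ₐ[ℂ] HolGerm) (f g : HolGerm) :
    interNum (e f) (e g) = interNum f g := by
  rw [interNum, interNum]
  congr 1
  refine ((Ideal.quotientEquivAlg (Ideal.span {f, g}) (Ideal.span {e f, e g}) e ?_)
    |>.toLinearEquiv.rank_eq).symm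
  rw [Ideal.map_span, Set.image_pair]
  rfl

/-- A germ of finite intersection number with `f ≠ 0` is a nonzerodivisor modulo `f`. -/
theorem dvd_of_dvd_mul_of_interNum_ne_top {f g a : HolGerm} (hf : f ≠ 0)
    (hfg : interNum f g ≠ ⊤) (h : f ∣ g * a) : f ∣ a := by
  have := finite_of_interNum_ne_top hfg
  have hle := maximalIdeal_pow_le_of_finrank_le (K := ℂ) maximalIdeal_fg
    (Ideal.span {f, g}) le_rfl
  generalize Module.finrank ℂ (HolGerm ⧸ Ideal.span {f, g}) = n at hle
  obtain ⟨b, hb⟩ := h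
  have key : ∀ z ∈ IsLocalRing.maximalIdeal HolGerm, f ∣ z ^ n * a := by
    intro z hz
    obtain ⟨c, d, hcd⟩ := Ideal.mem_span_pair.1 (hle (Ideal.pow_mem_pow hz n))
    exact ⟨c * a + d * b, by rw [← hcd]; linear_combination d * hb⟩
  obtain ⟨c, hc⟩ := key X (mem_maximalIdeal.2 rfl)
  obtain ⟨d, hd⟩ := key Y (mem_maximalIdeal.2 rfl)
  -- From `X ^ n * a = f * c` and `Y ^ n * a = f * d`, cancelling `f`; then `X ^ n` divides `c`,
  -- which exhibits `a` as a multiple of `f`.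
  have hcd : Y ^ n * c = X ^ n * d := by
    refine mul_left_cancel₀ hf ?_
    linear_combination -Y ^ n * hc + X ^ n * hd
  obtain ⟨e, rfl⟩ := X_pow_dvd_of_dvd_Y_pow_mul ⟨d, hcd⟩
  refine ⟨e, mul_left_cancel₀ (pow_ne_zero n X_ne_zero) ?_⟩
  rw [hc]
  ring

theorem interNum_mul_of_regular {f g : HolGerm} (hreg : ∀ a, f ∣ g * a → f ∣ a) (h : HolGerm) :
    interNum f (g * h) = interNum f g + interNum f h := by
  rw [interNum, interNum, interNum, rank_quotient_span_pair_mul hreg, map_add]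

theorem interNum_le_interNum_mul (f g h : HolGerm) : interNum f g ≤ interNum f (g * h) := by
  have hle := span_pair_mul_le f g h
  exact Cardinal.toENat.monotone' (LinearMap.rank_le_of_surjective
    (Ideal.Quotient.factorₐ ℂ hle).toLinearMap (Ideal.Quotient.factor_surjective hle))

/-- If `f` is nonzero and meets `g` finitely, `g` is regular modulo `f` and colengths add; if the
intersection is infinite, so are both sides. For `f = 0`, regularity of `g` is the domain property.
-/
theorem interNum_mul {f g : HolGerm} (hfg : f ≠ 0 ∨ g ≠ 0) (h : HolGerm) :
    interNum f (g * h) = interNum f g + interNum f h := by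
  by_cases hf : f = 0
  · subst hf
    have hg : g ≠ 0 := by simpa using hfg
    exact interNum_mul_of_regular (fun a ha => by
      rw [zero_dvd_iff] at ha ⊢
      exact (mul_eq_zero.1 ha).resolve_left hg) h
  · by_cases htop : interNum f g = ⊤
    · rw [htop, top_add, eq_top_iff, ← htop]
      exact interNum_le_interNum_mul f g h
    · exact interNum_mul_of_regular
        (fun a => dvd_of_dvd_mul_of_interNum_ne_top hf htop) h

theorem interNum_one (f : HolGerm) : interNum f 1 = 0 := by
  have : Ideal.span {f, 1} = ⊤ := (Ideal.eq_top_iff_one _).2 (Ideal.subset_span (by simp))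
  have : Subsingleton (HolGerm ⧸ Ideal.span {f, 1}) := Ideal.Quotient.subsingleton_iff.2 this
  rw [interNum, rank_subsingleton', map_zero]

theorem interNum_prod {ι : Type*} {f : HolGerm} {g : ι → HolGerm} {t : Finset ι}
    (h : f ≠ 0 ∨ ∀ i ∈ t, g i ≠ 0) :
    interNum f (∏ i ∈ t, g i) = ∑ i ∈ t, interNum f (g i) := by
  classical
  induction t using Finset.induction_on with
  | empty => simpa using interNum_one f
  | insert i t hi ih =>
    rw [Finset.prod_insert hi, Finset.sum_insert hi,
      interNum_mul (h.imp_right fun h => h i (by simp)),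
      ih (h.imp_right fun h j hj => h j (by simp [hj]))]

theorem interNum_pow {f : HolGerm} (hf : f ≠ 0) (g : HolGerm) (n : ℕ) :
    interNum f (g ^ n) = n * interNum f g := by
  have := interNum_prod (g := fun _ : Fin n => g) (t := Finset.univ) (Or.inl hf)
  simpa using this

end PlaneCurve

/-! ### Invariance of the inflection and vertex expressions -/

namespace PlaneCurve
open HolGerm

section
variable {R S : Type*} [CommRing R] [CommRing S]

theorem inflExpr_congr (π : R →+* S) {D E : R → R} (h : ∀ a, π (D a) = π (E a))
    (hE : ∀ a b, π a = π b → π (E a) = π (E b)) (p q : R) :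
    π (inflExpr D p q) = π (inflExpr E p q) := by
  have h2 (a) : π (D (D a)) = π (E (E a)) := (h _).trans (hE _ _ (h a))
  simp only [inflExpr, map_sub, map_mul, h2]
  simp only [h]

theorem vertExpr_congr (π : R →+* S) {D E : R → R} (h : ∀ a, π (D a) = π (E a))
    (hE : ∀ a b, π a = π b → π (E a) = π (E b)) (p q : R) :
    π (vertExpr D p q) = π (vertExpr E p q) := by
  have h2 (a) : π (D (D a)) = π (E (E a)) := (h _).trans (hE _ _ (h a))
  have h3 (a) : π (D (D (D a))) = π (E (E (E a))) := (h _).trans (hE _ _ (h2 a))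
  -- Highest iterates are rewritten first, since `h` alone would turn `π (D (D a))` into `π (E (D
  -- a))`.
  simp only [vertExpr, map_sub, map_add, map_mul, map_pow, h3]
  simp only [h2]
  simp only [h]

end

theorem tangentField_mul_left (a f g : HolGerm) :
    tangentField (a * f) g = a * tangentField f g + f * tangentField a g := by
  simp only [tangentField, jac, dx_mul, dy_mul]
  ring

theorem tangentField_pull (φ : Biholo) (f g : HolGerm) :
    tangentField (φ.pull f) (φ.pull g) =
      jac (φ.pull X) (φ.pull Y) * φ.pull (tangentField f g) := by
  rw [tangentField, φ.jac_pull, mul_comm]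
  rfl

/-- An expression `w f p q` of weight `c` attached to the curve `f = 0` and the map germ `(p, q)`,
such as the curvature of the image curve: it behaves well under multiplication of `f` by a germ
and under coordinate changes, and it is polynomial in `(p, q)`. -/
structure IsInvariantExpr (w : HolGerm → HolGerm → HolGerm → HolGerm) (c : ℕ) : Prop where
  dvd_sub : ∀ a f p q, f ∣ w (a * f) p q - a ^ c * w f p q
  pull : ∀ (φ : Biholo) f p q, w (φ.pull f) (φ.pull p) (φ.pull q) =
    jac (φ.pull X) (φ.pull Y) ^ c * φ.pull (w f p q)
  exists_polynomial : ∀ f p q p' q', ∃ P : Polynomial HolGerm, ∀ s : ℂ,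
    P.eval (algebraMap ℂ HolGerm s) = w f (p + s • p') (q + s • q')

theorem mk_tangentField_mul_left (a f : HolGerm) (g : HolGerm) :
    Ideal.Quotient.mk (Ideal.span {f}) (tangentField (a * f) g) =
      Ideal.Quotient.mk (Ideal.span {f}) (a * tangentField f g) := by
  rw [Ideal.Quotient.eq, Ideal.mem_span_singleton, tangentField_mul_left]
  exact ⟨tangentField a g, by ring⟩

/-- The field kills `f`, so it preserves the ideal of `f` and descends to functions on the curve;
this allows congruences to be iterated. -/
theorem mk_mul_tangentField_congr (a f : HolGerm) (g h : HolGerm)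
    (hgh : Ideal.Quotient.mk (Ideal.span {f}) g = Ideal.Quotient.mk (Ideal.span {f}) h) :
    Ideal.Quotient.mk (Ideal.span {f}) (a * tangentField f g) =
      Ideal.Quotient.mk (Ideal.span {f}) (a * tangentField f h) := by
  rw [Ideal.Quotient.eq, Ideal.mem_span_singleton] at hgh ⊢
  obtain ⟨c, hc⟩ := hgh
  obtain rfl : g = h + f * c := by rw [← hc]; ring
  rw [tangentField_add, tangentField_mul]
  have : tangentField f f = 0 := by
    simp only [tangentField, jac]
    ring
  rw [this]
  exact ⟨a * tangentField f c, by ring⟩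

theorem isInvariantExpr_inflExpr :
    IsInvariantExpr (fun f p q => inflExpr (tangentField f) p q) 3 where
  dvd_sub a f p q := by
    rw [← Ideal.mem_span_singleton, ← Ideal.Quotient.eq]
    refine (inflExpr_congr (R := HolGerm)
      (S := HolGerm ⧸ Ideal.span {f}) (Ideal.Quotient.mk (Ideal.span {f}))
      (E := fun g => a * tangentField f g) (mk_tangentField_mul_left a f)
      (mk_mul_tangentField_congr a f) p q).trans ?_
    rw [inflExpr_mul (tangentField_mul f) fun _ => rfl]
  pull φ f p q := by
    -- `E` is the field of `f` transported by `φ`. The field of the pulled-back curve is the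
    -- Jacobian times `E`, so the reparametrisation rule applies.
    let E : HolGerm → HolGerm := fun g => φ.pullEquiv (tangentField f (φ.pullEquiv.symm g))
    have hE (a b) : E (a * b) = a * E b + b * E a := by
      simp only [E, map_mul, tangentField_mul, map_add, AlgEquiv.apply_symm_apply]
    have hD (g) : tangentField (φ.pull f) g = jac (φ.pull X) (φ.pull Y) * E g := by
      obtain ⟨g, rfl⟩ := φ.pullEquiv.surjective g
      simp only [E, AlgEquiv.symm_apply_apply]
      exact tangentField_pull φ f g
    rw [inflExpr_mul hE hD, ← Biholo.pullEquiv_apply, ← Biholo.pullEquiv_apply,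
      ← Biholo.pullEquiv_apply φ (inflExpr _ _ _)]
    congr 1
    exact (map_inflExpr (φ.pullEquiv : HolGerm →+* HolGerm)
      (fun a => by simp [E]) p q).symm
  exists_polynomial f p q p' q' := by
    let l : HolGerm → HolGerm → Polynomial HolGerm := fun a b =>
      Polynomial.C a + Polynomial.X * Polynomial.C b
    let D := tangentField f
    refine ⟨l (D p) (D p') * l (D (D q)) (D (D q')) - l (D q) (D q') * l (D (D p)) (D (D p')),
      fun s => ?_⟩
    simp only [l, D, inflExpr, tangentField_add, tangentField_smul, Polynomial.eval_sub,
      Polynomial.eval_mul, Polynomial.eval_add, Polynomial.eval_C, Polynomial.eval_X]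
    simp only [Algebra.smul_def]

theorem isInvariantExpr_vertExpr :
    IsInvariantExpr (fun f p q => vertExpr (tangentField f) p q) 6 where
  dvd_sub a f p q := by
    rw [← Ideal.mem_span_singleton, ← Ideal.Quotient.eq]
    refine (vertExpr_congr (R := HolGerm)
      (S := HolGerm ⧸ Ideal.span {f}) (Ideal.Quotient.mk (Ideal.span {f}))
      (E := fun g => a * tangentField f g) (mk_tangentField_mul_left a f)
      (mk_mul_tangentField_congr a f) p q).trans ?_
    rw [vertExpr_mul (tangentField_mul f) (tangentField_add f) fun _ => rfl]
  pull φ f p q := by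
    let E : HolGerm → HolGerm := fun g => φ.pullEquiv (tangentField f (φ.pullEquiv.symm g))
    have hE (a b) : E (a * b) = a * E b + b * E a := by
      simp only [E, map_mul, tangentField_mul, map_add, AlgEquiv.apply_symm_apply]
    have hE' (a b) : E (a + b) = E a + E b := by
      simp only [E, map_add, tangentField_add]
    have hD (g) : tangentField (φ.pull f) g = jac (φ.pull X) (φ.pull Y) * E g := by
      obtain ⟨g, rfl⟩ := φ.pullEquiv.surjective g
      simp only [E, AlgEquiv.symm_apply_apply]
      exact tangentField_pull φ f g
    rw [vertExpr_mul hE hE' hD, ← Biholo.pullEquiv_apply, ← Biholo.pullEquiv_apply,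
      ← Biholo.pullEquiv_apply φ (vertExpr _ _ _)]
    congr 1
    exact (map_vertExpr (φ.pullEquiv : HolGerm →+* HolGerm)
      (fun a => by simp [E]) p q).symm
  exists_polynomial f p q p' q' := by
    let l : HolGerm → HolGerm → Polynomial HolGerm := fun a b =>
      Polynomial.C a + Polynomial.X * Polynomial.C b
    let D := tangentField f
    let p₁ := l (D p) (D p')
    let p₂ := l (D (D p)) (D (D p'))
    let p₃ := l (D (D (D p))) (D (D (D p')))
    let q₁ := l (D q) (D q')
    let q₂ := l (D (D q)) (D (D q'))
    let q₃ := l (D (D (D q))) (D (D (D q')))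
    refine ⟨(p₁ ^ 2 + q₁ ^ 2) * (p₁ * q₃ - q₁ * p₃) -
      3 * (p₁ * p₂ + q₁ * q₂) * (p₁ * q₂ - q₁ * p₂), fun s => ?_⟩
    simp only [p₁, p₂, p₃, q₁, q₂, q₃, l, D, vertExpr, tangentField_add, tangentField_smul,
      Polynomial.eval_sub, Polynomial.eval_mul, Polynomial.eval_add, Polynomial.eval_C,
      Polynomial.eval_X, Polynomial.eval_pow, Polynomial.eval_ofNat]
    simp only [Algebra.smul_def]

/-! ### Coordinate pairs and minimal values over the orbit -/

/-- The pairs of germs that are the components of a biholomorphic map germ. -/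
def IsCoord (p q : HolGerm) : Prop := eval p = 0 ∧ eval q = 0 ∧ eval (jac p q) ≠ 0

theorem Biholo.isCoord (φ : Biholo) : IsCoord (φ.pull X) (φ.pull Y) :=
  ⟨φ.eval_pull X, φ.eval_pull Y, isUnit_iff.1 φ.isUnit_jac⟩

theorem isCoord_X_Y : IsCoord X Y := by
  refine ⟨rfl, rfl, ?_⟩
  simp [jac, dx_X, dx_Y, dy_Y]

theorem eventually_isCoord {p q p' q' : HolGerm} (hp : eval p = 0) (hq : eval q = 0)
    (hp' : eval p' = 0) (hq' : eval q' = 0) {s₀ : ℂ}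
    (h : IsCoord (p + s₀ • p') (q + s₀ • q')) :
    ∀ᶠ s : ℂ in cofinite, IsCoord (p + s • p') (q + s • q') := by
  let l : HolGerm → HolGerm → Polynomial ℂ := fun a b =>
    Polynomial.C (eval a) + Polynomial.X * Polynomial.C (eval b)
  let d := l (dx p) (dx p') * l (dy q) (dy q') - l (dy p) (dy p') * l (dx q) (dx q')
  have hd (s : ℂ) : d.eval s = eval (jac (p + s • p') (q + s • q')) := by
    have h1 (a : HolGerm) : dx (s • a) = s • dx a := (dirDerivation (1, 0)).map_smul s a
    have h2 (a : HolGerm) : dy (s • a) = s • dy a := (dirDerivation (0, 1)).map_smul s a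
    simp only [d, l, jac, dx_add, dy_add, h1, h2, map_sub, map_mul, map_add, map_smul,
      Polynomial.eval_sub, Polynomial.eval_mul, Polynomial.eval_add, Polynomial.eval_C,
      Polynomial.eval_X, smul_eq_mul]
  have h₀ := h.2.2
  rw [← hd] at h₀
  filter_upwards [eventually_cofinite_eval_ne_zero h₀] with s hs
  exact ⟨by simp [hp, hp'], by simp [hq, hq'], by rwa [← hd]⟩

/-- The minimal value over the `𝒦`-orbit of `f` of the intersection number of a curve with its
expression `w`. -/
noncomputable def minNum (w : HolGerm → HolGerm → HolGerm → HolGerm) (f : HolGerm) : ℕ∞ :=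
  sInf {n | ∃ g, KEquiv f g ∧ interNum g (w g X Y) = n}

theorem minInflNum_eq (f : HolGerm) :
    minInflNum f = minNum (fun f p q => inflExpr (tangentField f) p q) f := by
  have h (g : HolGerm) : inflNum g = interNum g (inflExpr (tangentField g) X Y) := by
    have hneg (a : HolGerm) : -a = -1 * a := by ring
    rw [inflNum, inflGerm_eq, hneg, interNum_mul_unit_right isUnit_one.neg]
  simp only [minInflNum, minNum, h]

theorem minVertNum_eq (f : HolGerm) :
    minVertNum f = minNum (fun f p q => vertExpr (tangentField f) p q) f := by
  simp only [minVertNum, minNum, vertNum, vertGerm_eq]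

namespace IsInvariantExpr

variable {w : HolGerm → HolGerm → HolGerm → HolGerm} {c : ℕ} (hw : IsInvariantExpr w c)

include hw

/-- Trades a moving curve in fixed coordinates for a fixed curve in moving coordinates: `A` and the
Jacobian enter only through unit factors raised to the power `c`. -/
theorem interNum_orbit (f : HolGerm) (φ : Biholo) (A : HolGermˣ) :
    interNum (A * compInv f φ) (w (A * compInv f φ) X Y) =
      interNum f (w f (φ.pull X) (φ.pull Y)) := by
  rw [interNum_mul_unit_left A.isUnit, interNum_congr (hw.dvd_sub A (compInv f φ) X Y),
    interNum_mul_unit_right (A.isUnit.pow c), ← interNum_map φ.pullEquiv,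
    φ.pullEquiv_apply, φ.pullEquiv_apply, ← interNum_mul_unit_right (φ.isUnit_jac.pow c),
    ← hw.pull, φ.compInv_eq, φ.pull_pull_symm]

theorem minNum_le {f p q : HolGerm} (h : IsCoord p q) : minNum w f ≤ interNum f (w f p q) := by
  obtain ⟨φ, rfl, rfl⟩ := Biholo.exists_pull_eq h.1 h.2.1 h.2.2
  exact sInf_le ⟨(1 : HolGermˣ) * compInv f φ, ⟨φ, 1, rfl⟩, hw.interNum_orbit f φ 1⟩

theorem exists_minNum_eq (f : HolGerm) :
    ∃ p q, IsCoord p q ∧ interNum f (w f p q) = minNum w f := by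
  obtain ⟨g, ⟨φ, A, rfl⟩, hg⟩ : minNum w f ∈
      {n | ∃ g, KEquiv f g ∧ interNum g (w g X Y) = n} :=
    csInf_mem ⟨_, f, KEquiv.refl f, rfl⟩
  exact ⟨_, _, φ.isCoord, (hw.interNum_orbit f φ A).symm.trans hg⟩

/-- Finitely many curves attain their minimal values in a common coordinate system. -/
theorem exists_forall_minNum_eq {ι : Type*} (f : ι → HolGerm) (t : Finset ι) :
    ∃ p q, IsCoord p q ∧ ∀ i ∈ t, interNum (f i) (w (f i) p q) = minNum w (f i) := by
  classical
  induction t using Finset.induction_on with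
  | empty => exact ⟨X, Y, isCoord_X_Y, by simp⟩
  | insert j t hj ih =>
    obtain ⟨p, q, hpq, ht⟩ := ih
    obtain ⟨p', q', hpq', hj'⟩ := hw.exists_minNum_eq (f j)
    -- On the line through the two systems, `s₀ = 0` is optimal for the branches in `t` and `s₀ = 1`
    -- for `f j`. As `ℂ` is infinite, some `s` avoids all the finite exceptional sets.
    have hgen (i) (s₀ : ℂ) : ∀ᶠ s : ℂ in cofinite,
        interNum (f i) (w (f i) (p + s • (p' - p)) (q + s • (q' - q))) ≤
          interNum (f i) (w (f i) (p + s₀ • (p' - p)) (q + s₀ • (q' - q))) := by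
      obtain ⟨P, hP⟩ := hw.exists_polynomial (f i) p q (p' - p) (q' - q)
      simpa only [hP] using eventually_interNum_le (f i) P s₀
    have hcoord := eventually_isCoord hpq.1 hpq.2.1 (p' := p' - p) (q' := q' - q) (s₀ := 0)
      (by rw [map_sub, hpq.1, hpq'.1, sub_zero])
      (by rw [map_sub, hpq.2.1, hpq'.2.1, sub_zero]) (by simpa using hpq)
    have ht' : ∀ᶠ s : ℂ in cofinite, ∀ i ∈ t,
        interNum (f i) (w (f i) (p + s • (p' - p)) (q + s • (q' - q))) ≤ minNum w (f i) := by
      rw [Filter.eventually_all_finset]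
      intro i hi
      have := hgen i 0
      rwa [zero_smul, zero_smul, add_zero, add_zero, ht i hi] at this
    have hj'' := hgen j 1
    rw [one_smul, one_smul, add_sub_cancel, add_sub_cancel, hj'] at hj''
    obtain ⟨s, hs, hst, hsj⟩ := (hcoord.and (ht'.and hj'')).exists
    refine ⟨_, _, hs, fun i hi => le_antisymm ?_ (hw.minNum_le hs)⟩
    rcases Finset.mem_insert.1 hi with rfl | hi
    exacts [hsj, hst i hi]

/-- The contribution of the mutual intersections of the branches does not depend on the
coordinates. -/
theorem interNum_prod_eq {k : ℕ} {f : Fin k → HolGerm} (hf : ∀ j, f j ≠ 0) (p q : HolGerm) :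
    interNum (∏ j, f j) (w (∏ j, f j) p q) = ∑ j, interNum (f j) (w (f j) p q) +
      (2 * c : ℕ) * ∑ i, ∑ j ∈ Finset.Ioi i, interNum (f i) (f j) := by
  have hterm (j : Fin k) : interNum (w (∏ j, f j) p q) (f j) =
      interNum (f j) (w (f j) p q) + c * ∑ i ∈ {j}ᶜ, interNum (f j) (f i) := by
    have h1 : ∏ j, f j = (∏ i ∈ {j}ᶜ, f i) * f j := by
      rw [mul_comm]
      exact (Fintype.prod_eq_mul_prod_compl j f)
    rw [interNum_comm, h1, interNum_congr (hw.dvd_sub _ (f j) p q), interNum_mul (Or.inl (hf j)),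
      interNum_pow (hf j), interNum_prod (Or.inl (hf j)), add_comm]
  -- The expression `w` may vanish identically, as curvature does on a line, so additivity rests
  -- here on the factors `f j` being nonzero.
  rw [interNum_comm, interNum_prod (Or.inr fun j _ => hf j)]
  simp only [hterm, Finset.sum_add_distrib]
  congr 1
  rw [← Finset.mul_sum]
  -- Splitting the other branches by index shows each unordered pair counted once from either side,
  -- whence `2 * c`.
  have hsplit (j : Fin k) : ∑ i ∈ {j}ᶜ, interNum (f j) (f i) =
      ∑ i ∈ Finset.Ioi j, interNum (f j) (f i) + ∑ i ∈ Finset.Iio j, interNum (f j) (f i) := by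
    rw [← Finset.sum_union]
    · congr 1
      ext i
      simp only [Finset.mem_compl, Finset.mem_singleton, Finset.mem_union, Finset.mem_Ioi,
        Finset.mem_Iio]
      exact ne_iff_lt_or_gt.trans or_comm
    · rw [Finset.disjoint_left]
      intro i hi hi'
      exact absurd (Finset.mem_Ioi.1 hi) (Finset.mem_Iio.1 hi').not_gt
  have hswap : ∑ j, ∑ i ∈ Finset.Iio j, interNum (f j) (f i) =
      ∑ i, ∑ j ∈ Finset.Ioi i, interNum (f i) (f j) := by
    rw [Finset.sum_comm' (t' := Finset.univ) (s' := fun i => Finset.Ioi i) (by simp)]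
    simp only [interNum_comm]
  simp only [hsplit, Finset.sum_add_distrib, hswap]
  push_cast
  ring

/-- Coordinates optimal for all branches at once bound the left side above; coordinates optimal for
the product bound each branch minimum above. -/
theorem minNum_prod {k : ℕ} {f : Fin k → HolGerm} (hf : ∀ j, f j ≠ 0) :
    minNum w (∏ j, f j) = ∑ j, minNum w (f j) +
      (2 * c : ℕ) * ∑ i, ∑ j ∈ Finset.Ioi i, interNum (f i) (f j) := by
  apply le_antisymm
  · obtain ⟨p, q, hpq, h⟩ := hw.exists_forall_minNum_eq f Finset.univ
    refine (hw.minNum_le hpq).trans_eq ?_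
    rw [hw.interNum_prod_eq hf, Finset.sum_congr rfl h]
  · obtain ⟨p, q, hpq, h⟩ := hw.exists_minNum_eq (∏ j, f j)
    rw [← h, hw.interNum_prod_eq hf]
    gcongr
    exact hw.minNum_le hpq

end IsInvariantExpr

end PlaneCurve

theorem mainTheorem7 (k : ℕ) (f : Fin k → PlaneCurve.HolGerm)
    (hirr : ∀ j, Irreducible (f j)) (hred : Squarefree (∏ j, f j)) :
    PlaneCurve.minInflNum (∏ j, f j) =
        ∑ j, PlaneCurve.minInflNum (f j)
          + 6 * ∑ i, ∑ j ∈ Finset.Ioi i, PlaneCurve.interNum (f i) (f j) ∧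
      PlaneCurve.minVertNum (∏ j, f j) =
        ∑ j, PlaneCurve.minVertNum (f j)
          + 12 * ∑ i, ∑ j ∈ Finset.Ioi i, PlaneCurve.interNum (f i) (f j) := by
  have hf (j) : f j ≠ 0 := (hirr j).ne_zero
  simp only [PlaneCurve.minInflNum_eq, PlaneCurve.minVertNum_eq]
  -- The weights 3 and 6 give the coefficients `2 * 3 = 6` and `2 * 6 = 12`.
  exact ⟨PlaneCurve.isInvariantExpr_inflExpr.minNum_prod hf,
    PlaneCurve.isInvariantExpr_vertExpr.minNum_prod hf⟩
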